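/- Fix $\mathbb K\in\{\mathbb R,\mathbb C\}$; all spaces are over $\mathbb K$. A \emph{Banach dual pair} $\langle X,Y\rangle$ consists of Banach spaces $X,Y$ and a bounded bilinear form $\langle\cdot,\cdot\rangle$ on $X\times Y$ for which both induced maps $X\to Y^*$ and $Y\to X^*$ are injective. For a pairing $\langle V,V'\rangle$, $\sigma(V,V')$ is the topology on $V$ generated by the functionals $\langle\cdot,v'\rangle$, $v'\in V'$. A \emph{Banach function space} on a measure space $(B,\nu)$ is an ideal of $L^0(B)$ with a complete lattice norm. A \emph{Köthe dual pair} $\langle F,G\rangle$ on $B$ consists of Banach function spaces $F,G$ on $B$ with $F\cdot G\subset L^1(B)$ that form a Banach dual pair under $\langle f,g\rangle=\int_B fg\,d\nu$. For a Banach function space $E$ on $B$ and a Banach space $X$, $E(X)$ is the space of (classes of) strongly measurable $f:B\to X$ with $\|f\|_X\in E$, normed by $\big\|\,\|f\|_X\big\|_E$; $E\otimes X$ is the linear span in $E(X)$ of the functions $e\otimes x: b\mapsto e(b)x$, and $E\tilde\otimes X$ is its closure in $E(X)$. The pairings of $L^1(A;X)$ with $L^\infty(A;Y)$ and of $F\tilde\otimes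 X$ with $G(Y)$ are $\int\langle f,g\rangle_{\langle X,Y\rangle}$. For Banach function spaces $E,H$ (possibly on different measure spaces), a positive operator $R\in\mathcal L(E,H)$ \emph{dominates} $T\in\mathcal L(E,H)$ if $|Te|\le R|e|$ for all $e\in E$; $M(E,H)$ is the set of operators dominated by a positive operator, with $\|T\|_{M(E,H)}=\inf\{\|R\|: R\ge 0 \text{ dominates } T\}$; $\mathcal L_r(E,H)$ is the set of \emph{regular} operators, i.e. linear combinations of positive operators, and $\|T\|_r=\|T\|_{M(E,H)}$ for regular $T$. The operator $T\otimes I_Y$ is determined by $(T\otimes I_Y)(e\otimes y)=Te\otimes y$. \textbf{Theorem.} Let $(A,\mathscr A,\mu)$ be a semi-finite measure space, let $\langle F,G\rangle$ be a Köthe dual pair of Banach function spaces over a measure space $(B,\mathscr B,\nu)$, and let $T\in\mathcal L(L^\infty(A),G)$ be $\sigma(L^\infty(A),L^1(A))$-to-$\sigma(G,F)$ continuous; then $T$ has a unique adjoint $S\in\mathcal L(F,L^1(A))$, that is, $\langle Sf,h\rangle=\langle f,Th\rangle$ for all $f\in F$, $h\in L^\infty(A)$. Suppose that $T\in M(L^\infty(A),G)$.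 Then, for every Banach dual pair $\langle X,Y\rangle$: (1) $T\otimes I_Y$ has a unique extension to a $\sigma(L^\infty(A;Y),L^1(A;X))$-to-$\sigma(G(Y),F\tilde\otimes X)$ continuous linear operator $T_Y\in\mathcal L(L^\infty(A;Y),G(Y))$. (2) $T_Y$ is the $Y$-valued extension of $T$ with respect to $\langle X,Y\rangle$: $\langle x,T_Yh\rangle=T\langle x,h\rangle$ for all $h\in L^\infty(A;Y)$ and $x\in X$. (3) $T_Y$ has an adjoint $S_X\in\mathcal L(F\tilde\otimes X,L^1(A;X))$, that is, $\langle S_X\varphi,h\rangle=\langle\varphi,T_Yh\rangle$ for all $\varphi\in F\tilde\otimes X$, $h\in L^\infty(A;Y)$, and $S_X$ is the unique bounded extension of $S\otimes I_X$. Moreover, $S\in M(F,L^1(A))=\mathcal L_r(F,L^1(A))$, $\|S_X\|\le\|S\|_r$ and $\|T_Y\|\le\|T\|_{M(L^\infty(A),G)}$. -/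

import Mathlib

open MeasureTheory Filter Topology
open scoped ENNReal ComplexOrder

noncomputable section

/-! ### Banach function spaces -/

/-- A Banach function space over `𝕜` on the measure space `(B, ν)`: an ideal of `L⁰(B)`
equipped with a complete lattice norm. -/
structure BanachFunctionSpace (𝕜 : Type*) [RCLike 𝕜] {B : Type*} [MeasurableSpace B]
    (ν : Measure B) where
  /-- The underlying linear subspace of `L⁰(B)`. -/
  carrier : Submodule 𝕜 (B →ₘ[ν] 𝕜)
  /-- The subspace is an ideal (it is solid). -/
  ideal : ∀ f g : B →ₘ[ν] 𝕜, g ∈ carrier → (∀ᵐ b ∂ν, ‖f b‖ ≤ ‖g b‖) → f ∈ carrier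
  /-- The norm. -/
  nrm : carrier → ℝ
  /-- `nrm` is a norm. -/
  core : letI : Norm carrier := ⟨nrm⟩; NormedSpace.Core 𝕜 carrier
  /-- `nrm` is a lattice norm. -/
  mono : ∀ f g : carrier, (∀ᵐ b ∂ν, ‖(f : B →ₘ[ν] 𝕜) b‖ ≤ ‖(g : B →ₘ[ν] 𝕜) b‖) → nrm f ≤ nrm g
  /-- `nrm` is complete. -/
  complete : ∀ u : ℕ → carrier,
    (∀ ε > 0, ∃ N, ∀ m ≥ N, ∀ n ≥ N, nrm (u m - u n) < ε) →
      ∃ f : carrier, Tendsto (fun n => nrm (u n - f)) atTop (𝓝 0)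

namespace BanachFunctionSpace

variable {𝕜 : Type*} [RCLike 𝕜] {B : Type*} [MeasurableSpace B] {ν : Measure B}
  (E : BanachFunctionSpace 𝕜 ν)

instance instNorm : Norm E.carrier := ⟨E.nrm⟩

instance instNormedAddCommGroup : NormedAddCommGroup E.carrier :=
  NormedAddCommGroup.ofCore E.core

instance instNormedSpace : NormedSpace 𝕜 E.carrier := NormedSpace.ofCore E.core

theorem norm_def (f : E.carrier) : ‖f‖ = E.nrm f := rfl

instance instCompleteSpace : CompleteSpace E.carrier := by
  refine Metric.complete_of_cauchySeq_tendsto fun u hu => ?_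
  obtain ⟨f, hf⟩ := E.complete u (fun ε hε => by
    obtain ⟨N, hN⟩ := Metric.cauchySeq_iff.1 hu ε hε
    exact ⟨N, fun m hm n hn => by simpa [dist_eq_norm, norm_def] using hN m hm n hn⟩)
  exact ⟨f, tendsto_iff_norm_sub_tendsto_zero.2 hf⟩

end BanachFunctionSpace

/-! ### Functions with values in a Banach space -/

/-- The class in `L⁰(B)` of the function `b ↦ ‖f b‖`, regarded as a `𝕜`-valued function. -/
def normFun (𝕜 : Type*) [RCLike 𝕜] {B : Type*} [MeasurableSpace B] {ν : Measure B}
    {X : Type*} [NormedAddCommGroup X] (f : B →ₘ[ν] X) : B →ₘ[ν] 𝕜 :=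
  AEEqFun.comp (fun x : X => ((‖x‖ : ℝ) : 𝕜)) (by fun_prop) f

theorem coeFn_normFun {𝕜 : Type*} [RCLike 𝕜] {B : Type*} [MeasurableSpace B] {ν : Measure B}
    {X : Type*} [NormedAddCommGroup X] (f : B →ₘ[ν] X) :
    ∀ᵐ b ∂ν, normFun 𝕜 f b = ((‖f b‖ : ℝ) : 𝕜) :=
  AEEqFun.coeFn_comp _ _ f

section Valued

variable {𝕜 : Type*} [RCLike 𝕜] {B : Type*} [MeasurableSpace B] {ν : Measure B}
  {X Y : Type*} [NormedAddCommGroup X] [NormedSpace 𝕜 X] [NormedAddCommGroup Y] [NormedSpace 𝕜 Y]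

/-- The elementary tensor `f ⊗ x`, that is, the class of the function `b ↦ f b • x`. -/
def elemTensor (f : B →ₘ[ν] 𝕜) (x : X) : B →ₘ[ν] X :=
  AEEqFun.comp (fun c : 𝕜 => c • x) (by fun_prop) f

theorem coeFn_elemTensor (f : B →ₘ[ν] 𝕜) (x : X) :
    ∀ᵐ b ∂ν, elemTensor f x b = f b • x :=
  AEEqFun.coeFn_comp _ _ f

namespace BanachFunctionSpace

variable (E : BanachFunctionSpace 𝕜 ν)

theorem mem_of_norm_le {f : B →ₘ[ν] 𝕜} {g : B →ₘ[ν] 𝕜} (hg : g ∈ E.carrier)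
    (h : ∀ᵐ b ∂ν, ‖f b‖ ≤ ‖g b‖) : f ∈ E.carrier := E.ideal f g hg h

/-- The Köthe–Bochner space `E(X)` of all classes `f` of strongly measurable functions `B → X`
with `‖f‖ ∈ E`, as a linear subspace of `L⁰(B; X)`. -/
def bochnerSubmodule (X : Type*) [NormedAddCommGroup X] [NormedSpace 𝕜 X] :
    Submodule 𝕜 (B →ₘ[ν] X) where
  carrier := {f | normFun 𝕜 f ∈ E.carrier}
  zero_mem' := by
    refine E.mem_of_norm_le (g := 0) E.carrier.zero_mem ?_
    filter_upwards [coeFn_normFun (𝕜 := 𝕜) (0 : B →ₘ[ν] X),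
      AEEqFun.coeFn_zero (μ := ν) (α := B) (β := X)] with b h1 h2
    simp [h1, h2]
  add_mem' := by
    intro f g hf hg
    refine E.mem_of_norm_le (g := normFun 𝕜 f + normFun 𝕜 g) (E.carrier.add_mem hf hg) ?_
    filter_upwards [coeFn_normFun (𝕜 := 𝕜) (f + g), AEEqFun.coeFn_add f g,
      AEEqFun.coeFn_add (normFun 𝕜 f) (normFun 𝕜 g), coeFn_normFun (𝕜 := 𝕜) f,
      coeFn_normFun (𝕜 := 𝕜) g] with b h1 h2 h3 h4 h5
    rw [h1, h3, Pi.add_apply, h4, h5, h2, Pi.add_apply, ← RCLike.ofReal_add]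
    simp only [RCLike.norm_ofReal, abs_norm]
    rw [abs_of_nonneg (by positivity)]
    exact norm_add_le _ _
  smul_mem' := by
    intro c f hf
    refine E.mem_of_norm_le (g := c • normFun 𝕜 f) (E.carrier.smul_mem c hf) ?_
    filter_upwards [coeFn_normFun (𝕜 := 𝕜) (c • f), AEEqFun.coeFn_smul c f,
      AEEqFun.coeFn_smul c (normFun 𝕜 f), coeFn_normFun (𝕜 := 𝕜) f] with b h1 h2 h3 h4
    rw [h1, h3, Pi.smul_apply, h4, h2, Pi.smul_apply]
    simp [norm_smul]

/-- The Köthe–Bochner space `E(X)`. -/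
def Bochner (X : Type*) [NormedAddCommGroup X] [NormedSpace 𝕜 X] : Type _ :=
  E.bochnerSubmodule X

namespace Bochner

instance instAddCommGroup : AddCommGroup (E.Bochner X) :=
  inferInstanceAs (AddCommGroup (E.bochnerSubmodule X))

instance instModule : Module 𝕜 (E.Bochner X) :=
  inferInstanceAs (Module 𝕜 (E.bochnerSubmodule X))

variable {E}

/-- The underlying class of functions of an element of `E(X)`. -/
def toAEEqFun (f : E.Bochner X) : B →ₘ[ν] X := f.1

instance instCoeOut : CoeOut (E.Bochner X) (B →ₘ[ν] X) := ⟨toAEEqFun⟩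

theorem ext {f g : E.Bochner X} (h : (f : B →ₘ[ν] X) = g) : f = g := Subtype.ext h

theorem coe_add (f g : E.Bochner X) : ((f + g : E.Bochner X) : B →ₘ[ν] X) = f + g := rfl

theorem coe_smul (c : 𝕜) (f : E.Bochner X) : ((c • f : E.Bochner X) : B →ₘ[ν] X) = c • f := rfl

theorem coe_zero : ((0 : E.Bochner X) : B →ₘ[ν] X) = 0 := rfl

/-- The element `‖f‖` of `E`, for `f` in `E(X)`. -/
def normElt (f : E.Bochner X) : E.carrier := ⟨normFun 𝕜 (f : B →ₘ[ν] X), f.2⟩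

theorem coeFn_normElt (f : E.Bochner X) :
    ∀ᵐ b ∂ν, (normElt f : B →ₘ[ν] 𝕜) b = ((‖(f : B →ₘ[ν] X) b‖ : ℝ) : 𝕜) :=
  coeFn_normFun _

/-- The norm of `E(X)`: the norm in `E` of `‖f‖`. -/
instance instNorm : Norm (E.Bochner X) := ⟨fun f => ‖normElt f‖⟩

theorem norm_def (f : E.Bochner X) : ‖f‖ = ‖normElt f‖ := rfl

theorem normedSpaceCore : NormedSpace.Core 𝕜 (E.Bochner X) where
  norm_nonneg f := norm_nonneg (normElt f)
  norm_smul c f := by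
    rw [norm_def, norm_def, ← norm_smul]
    have h : ∀ᵐ b ∂ν, ‖(normElt (c • f) : B →ₘ[ν] 𝕜) b‖
        = ‖((c • normElt f : E.carrier) : B →ₘ[ν] 𝕜) b‖ := by
      filter_upwards [coeFn_normElt (c • f), coeFn_normElt f,
        AEEqFun.coeFn_smul c (f : B →ₘ[ν] X),
        AEEqFun.coeFn_smul c (normElt f : B →ₘ[ν] 𝕜)] with b h1 h2 h3 h4
      rw [h1, Submodule.coe_smul, h4, Pi.smul_apply, h2, coe_smul, h3, Pi.smul_apply]
      simp [norm_smul]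
    exact le_antisymm (E.mono _ _ (h.mono fun _ hb => hb.le)) (E.mono _ _ (h.mono fun _ hb => hb.ge))
  norm_triangle f g := by
    rw [norm_def, norm_def, norm_def]
    refine le_trans (E.mono _ (normElt f + normElt g) ?_) (norm_add_le (normElt f) (normElt g))
    filter_upwards [coeFn_normElt (f + g), coeFn_normElt f, coeFn_normElt g,
      AEEqFun.coeFn_add (f : B →ₘ[ν] X) (g : B →ₘ[ν] X),
      AEEqFun.coeFn_add (normElt f : B →ₘ[ν] 𝕜) (normElt g : B →ₘ[ν] 𝕜)] with b h1 h2 h3 h4 h5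
    rw [h1, Submodule.coe_add, h5, Pi.add_apply, h2, h3, coe_add, h4, Pi.add_apply,
      ← RCLike.ofReal_add]
    simp only [RCLike.norm_ofReal, abs_norm]
    rw [abs_of_nonneg (by positivity)]
    exact norm_add_le _ _
  norm_eq_zero_iff f := by
    rw [norm_def, norm_eq_zero]
    constructor
    · intro h
      apply ext
      apply AEEqFun.ext
      have h0 : (normElt f : B →ₘ[ν] 𝕜) = 0 := by rw [h]; rfl
      filter_upwards [coeFn_normElt f, AEEqFun.coeFn_zero (μ := ν) (α := B) (β := X),
        AEEqFun.coeFn_zero (μ := ν) (α := B) (β := 𝕜)] with b h1 h2 h3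
      rw [h0, h3] at h1
      rw [coe_zero, h2]
      have h4 := h1.symm
      simpa using h4
    · rintro rfl
      apply Subtype.ext
      apply AEEqFun.ext
      filter_upwards [coeFn_normElt (0 : E.Bochner X),
        AEEqFun.coeFn_zero (μ := ν) (α := B) (β := X),
        AEEqFun.coeFn_zero (μ := ν) (α := B) (β := 𝕜)] with b h1 h2 h3
      rw [h1, coe_zero, h2, Submodule.coe_zero, h3]
      simp

instance instNormedAddCommGroup : NormedAddCommGroup (E.Bochner X) :=
  NormedAddCommGroup.ofCore normedSpaceCore

instance instNormedSpace : NormedSpace 𝕜 (E.Bochner X) := NormedSpace.ofCore normedSpaceCore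

/-- The elementary tensor `f ⊗ x` as an element of `E(X)`. -/
def tensor (f : E.carrier) (x : X) : E.Bochner X :=
  ⟨elemTensor (f : B →ₘ[ν] 𝕜) x, by
    refine E.mem_of_norm_le (E.carrier.smul_mem ((‖x‖ : ℝ) : 𝕜) f.2) ?_
    filter_upwards [coeFn_normFun (𝕜 := 𝕜) (elemTensor (f : B →ₘ[ν] 𝕜) x),
      coeFn_elemTensor (f : B →ₘ[ν] 𝕜) x,
      AEEqFun.coeFn_smul ((‖x‖ : ℝ) : 𝕜) (f : B →ₘ[ν] 𝕜)] with b h1 h2 h3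
    rw [h1, h2, h3, Pi.smul_apply]
    simp [norm_smul, mul_comm]⟩

end Bochner

/-- `E ⊗̃ X`: the closure in `E(X)` of the linear span `E ⊗ X` of the elementary tensors. -/
def tensorClosure (X : Type*) [NormedAddCommGroup X] [NormedSpace 𝕜 X] :
    Submodule 𝕜 (E.Bochner X) :=
  (Submodule.span 𝕜 {φ | ∃ (f : E.carrier) (x : X), φ = Bochner.tensor f x}).topologicalClosure

variable {E} in
/-- The elementary tensor `f ⊗ x` as an element of `E ⊗̃ X`. -/
def tensorMk (f : E.carrier) (x : X) : E.tensorClosure X :=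
  ⟨Bochner.tensor f x,
    Submodule.le_topologicalClosure _ (Submodule.subset_span ⟨f, x, rfl⟩)⟩

end BanachFunctionSpace

end Valued

/-! ### Dual pairs and their weak topologies -/

/-- The bounded bilinear form `b` is a Banach duality between `X` and `Y`: both induced maps
`X → Y*` and `Y → X*` are injective. -/
structure IsBanachDualPair {𝕜 : Type*} [RCLike 𝕜] {X Y : Type*} [NormedAddCommGroup X]
    [NormedSpace 𝕜 X] [NormedAddCommGroup Y] [NormedSpace 𝕜 Y] (b : X →L[𝕜] Y →L[𝕜] 𝕜) :
    Prop where
  injective_left : Function.Injective b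
  injective_right : Function.Injective b.flip

/-- Given pairings `p` of `V` with `V'` and `q` of `W` with `W'`, the linear map `T : V → W` is
`σ(V, V')`-to-`σ(W, W')` continuous. -/
def WeakWeakContinuous {𝕜 : Type*} [RCLike 𝕜] {V V' W W' : Type*} [AddCommGroup V] [Module 𝕜 V]
    [AddCommGroup V'] [Module 𝕜 V'] [AddCommGroup W] [Module 𝕜 W] [AddCommGroup W'] [Module 𝕜 W']
    (p : V →ₗ[𝕜] V' →ₗ[𝕜] 𝕜) (q : W →ₗ[𝕜] W' →ₗ[𝕜] 𝕜) (T : V →ₗ[𝕜] W) : Prop :=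
  Continuous (X := WeakBilin p) (Y := WeakBilin q) T

/-- `⟨F, G⟩` is a Köthe dual pair: `F · G ⊆ L¹(B)`, and `(f, g) ↦ ∫ f g` is a Banach duality. -/
structure IsKoetheDualPair {𝕜 : Type*} [RCLike 𝕜] {B : Type*} [MeasurableSpace B] {ν : Measure B}
    (F G : BanachFunctionSpace 𝕜 ν) : Prop where
  integrable : ∀ (f : F.carrier) (g : G.carrier),
    Integrable (fun b => (f : B →ₘ[ν] 𝕜) b * (g : B →ₘ[ν] 𝕜) b) ν
  bounded : ∃ C : ℝ, ∀ (f : F.carrier) (g : G.carrier),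
    ‖∫ b, (f : B →ₘ[ν] 𝕜) b * (g : B →ₘ[ν] 𝕜) b ∂ν‖ ≤ C * ‖f‖ * ‖g‖
  separating_left : ∀ f : F.carrier,
    (∀ g : G.carrier, ∫ b, (f : B →ₘ[ν] 𝕜) b * (g : B →ₘ[ν] 𝕜) b ∂ν = 0) → f = 0
  separating_right : ∀ g : G.carrier,
    (∀ f : F.carrier, ∫ b, (f : B →ₘ[ν] 𝕜) b * (g : B →ₘ[ν] 𝕜) b ∂ν = 0) → g = 0

namespace IsKoetheDualPair

variable {𝕜 : Type*} [RCLike 𝕜] {B : Type*} [MeasurableSpace B] {ν : Measure B}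
  {F G : BanachFunctionSpace 𝕜 ν} {X Y : Type*} [NormedAddCommGroup X] [NormedSpace 𝕜 X]
  [NormedAddCommGroup Y] [NormedSpace 𝕜 Y]

/-- The pairing `⟨f, g⟩ = ∫ f g` between `F` and `G`. -/
def pairing (h : IsKoetheDualPair F G) : F.carrier →ₗ[𝕜] G.carrier →ₗ[𝕜] 𝕜 :=
  LinearMap.mk₂ 𝕜 (fun f g => ∫ b, (f : B →ₘ[ν] 𝕜) b * (g : B →ₘ[ν] 𝕜) b ∂ν)
    (fun f f' g => by
      rw [← integral_add (h.integrable f g) (h.integrable f' g)]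
      apply integral_congr_ae
      filter_upwards [AEEqFun.coeFn_add (f : B →ₘ[ν] 𝕜) f'] with b hb
      rw [Submodule.coe_add, hb, Pi.add_apply, add_mul])
    (fun c f g => by
      rw [smul_eq_mul, ← integral_const_mul]
      apply integral_congr_ae
      filter_upwards [AEEqFun.coeFn_smul c (f : B →ₘ[ν] 𝕜)] with b hb
      rw [Submodule.coe_smul, hb, Pi.smul_apply, smul_eq_mul, mul_assoc])
    (fun f g g' => by
      rw [← integral_add (h.integrable f g) (h.integrable f g')]
      apply integral_congr_ae
      filter_upwards [AEEqFun.coeFn_add (g : B →ₘ[ν] 𝕜) g'] with b hb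
      rw [Submodule.coe_add, hb, Pi.add_apply, mul_add])
    (fun c f g => by
      rw [smul_eq_mul, ← integral_const_mul]
      apply integral_congr_ae
      filter_upwards [AEEqFun.coeFn_smul c (g : B →ₘ[ν] 𝕜)] with b hb
      rw [Submodule.coe_smul, hb, Pi.smul_apply, smul_eq_mul, mul_left_comm])

theorem pairing_apply (h : IsKoetheDualPair F G) (f : F.carrier) (g : G.carrier) :
    h.pairing f g = ∫ b, (f : B →ₘ[ν] 𝕜) b * (g : B →ₘ[ν] 𝕜) b ∂ν := rfl

theorem integrable_bochner (h : IsKoetheDualPair F G) (β : X →L[𝕜] Y →L[𝕜] 𝕜)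
    (f : F.Bochner X) (g : G.Bochner Y) :
    Integrable (fun b => β ((f : B →ₘ[ν] X) b) ((g : B →ₘ[ν] Y) b)) ν := by
  refine ((h.integrable f.normElt g.normElt).norm.const_mul ‖β‖).mono'
    (β.aestronglyMeasurable_comp₂ (AEEqFun.aestronglyMeasurable _)
      (AEEqFun.aestronglyMeasurable _)) ?_
  filter_upwards [f.coeFn_normElt, g.coeFn_normElt] with b h1 h2
  rw [h1, h2]
  simpa [mul_assoc] using β.le_opNorm₂ ((f : B →ₘ[ν] X) b) ((g : B →ₘ[ν] Y) b)

/-- The pairing `⟨f, g⟩ = ∫ ⟨f(b), g(b)⟩ dν(b)` between `F(X)` and `G(Y)` induced by a bounded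
bilinear form `β` on `X × Y`. -/
def bochnerPairing (h : IsKoetheDualPair F G) (β : X →L[𝕜] Y →L[𝕜] 𝕜) :
    F.Bochner X →ₗ[𝕜] G.Bochner Y →ₗ[𝕜] 𝕜 :=
  LinearMap.mk₂ 𝕜 (fun f g => ∫ b, β ((f : B →ₘ[ν] X) b) ((g : B →ₘ[ν] Y) b) ∂ν)
    (fun f f' g => by
      rw [← integral_add (h.integrable_bochner β f g) (h.integrable_bochner β f' g)]
      apply integral_congr_ae
      filter_upwards [AEEqFun.coeFn_add (f : B →ₘ[ν] X) f'] with b hb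
      simp [BanachFunctionSpace.Bochner.coe_add, hb])
    (fun c f g => by
      rw [smul_eq_mul, ← integral_const_mul]
      apply integral_congr_ae
      filter_upwards [AEEqFun.coeFn_smul c (f : B →ₘ[ν] X)] with b hb
      simp [BanachFunctionSpace.Bochner.coe_smul, hb])
    (fun f g g' => by
      rw [← integral_add (h.integrable_bochner β f g) (h.integrable_bochner β f g')]
      apply integral_congr_ae
      filter_upwards [AEEqFun.coeFn_add (g : B →ₘ[ν] Y) g'] with b hb
      simp [BanachFunctionSpace.Bochner.coe_add, hb])
    (fun c f g => by
      rw [smul_eq_mul, ← integral_const_mul]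
      apply integral_congr_ae
      filter_upwards [AEEqFun.coeFn_smul c (g : B →ₘ[ν] Y)] with b hb
      simp [BanachFunctionSpace.Bochner.coe_smul, hb])

theorem bochnerPairing_apply (h : IsKoetheDualPair F G) (β : X →L[𝕜] Y →L[𝕜] 𝕜)
    (f : F.Bochner X) (g : G.Bochner Y) :
    h.bochnerPairing β f g = ∫ b, β ((f : B →ₘ[ν] X) b) ((g : B →ₘ[ν] Y) b) ∂ν := rfl

/-- The restriction of `⟨·, ·⟩` to a pairing between `F ⊗̃ X` and `G(Y)`. -/
def tensorPairing (h : IsKoetheDualPair F G) (β : X →L[𝕜] Y →L[𝕜] 𝕜) :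
    F.tensorClosure X →ₗ[𝕜] G.Bochner Y →ₗ[𝕜] 𝕜 :=
  (h.bochnerPairing β).domRestrict (F.tensorClosure X)

end IsKoetheDualPair

/-- The pairing `⟨f, g⟩ = ∫ ⟨f(a), g(a)⟩ dμ(a)` between `L¹(A; X)` and `L^∞(A; Y)` induced by a
bounded bilinear form `β` on `X × Y`. -/
def lOneLInftyPairing {𝕜 : Type*} [RCLike 𝕜] {A : Type*} [MeasurableSpace A] (μ : Measure A)
    {X Y : Type*} [NormedAddCommGroup X] [NormedSpace 𝕜 X] [NormedAddCommGroup Y]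
    [NormedSpace 𝕜 Y] (β : X →L[𝕜] Y →L[𝕜] 𝕜) : Lp X 1 μ →ₗ[𝕜] Lp Y ∞ μ →ₗ[𝕜] 𝕜 :=
  (β.lpPairing μ 1 ∞).toLinearMap₁₂

theorem lOneLInftyPairing_apply {𝕜 : Type*} [RCLike 𝕜] {A : Type*} [MeasurableSpace A]
    (μ : Measure A) {X Y : Type*} [NormedAddCommGroup X] [NormedSpace 𝕜 X] [NormedAddCommGroup Y]
    [NormedSpace 𝕜 Y] (β : X →L[𝕜] Y →L[𝕜] 𝕜) (f : Lp X 1 μ) (g : Lp Y ∞ μ) :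
    lOneLInftyPairing μ β f g = ∫ a, β (f a) (g a) ∂μ :=
  β.lpPairing_eq_integral f g

/-! ### Positive, dominated and regular operators

`E` and `F` stand for Banach lattices of (classes of) scalar functions, such as Mathlib's
`Lp 𝕜 p μ` or the carrier of a `BanachFunctionSpace`. -/

section Operators

variable {𝕜 : Type*} [RCLike 𝕜] {A : Type*} [MeasurableSpace A] {μ : Measure A}
  {B : Type*} [MeasurableSpace B] {ν : Measure B}
  {σ : Type*} [SetLike σ (A →ₘ[μ] 𝕜)] {E : σ} [NormedAddCommGroup E] [NormedSpace 𝕜 E]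
  {τ : Type*} [SetLike τ (B →ₘ[ν] 𝕜)] {F : τ} [NormedAddCommGroup F] [NormedSpace 𝕜 F]

/-- The operator `R` is positive. -/
def IsPositiveOp (R : E →L[𝕜] F) : Prop :=
  ∀ e : E, (∀ᵐ a ∂μ, 0 ≤ (e : A →ₘ[μ] 𝕜) a) → ∀ᵐ b ∂ν, 0 ≤ (R e : B →ₘ[ν] 𝕜) b

/-- `R` is a dominant of `T`: `R` is positive and `|T e| ≤ R |e|` for all `e` in `E`. -/
def IsDominant (T R : E →L[𝕜] F) : Prop :=
  IsPositiveOp R ∧ ∀ e e' : E,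
    (∀ᵐ a ∂μ, (e' : A →ₘ[μ] 𝕜) a = ((‖(e : A →ₘ[μ] 𝕜) a‖ : ℝ) : 𝕜)) →
      ∀ᵐ b ∂ν, ((‖(T e : B →ₘ[ν] 𝕜) b‖ : ℝ) : 𝕜) ≤ (R e' : B →ₘ[ν] 𝕜) b

/-- `T ∈ M(E, F)`: `T` is dominated by a positive operator. -/
def IsDominated (T : E →L[𝕜] F) : Prop := ∃ R : E →L[𝕜] F, IsDominant T R

/-- The norm of `M(E, F)`: the infimum of the norms of the dominants of `T`. On regular operators
this is the regular norm. -/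
def dominatedNorm (T : E →L[𝕜] F) : ℝ := sInf {r | ∃ R : E →L[𝕜] F, IsDominant T R ∧ r = ‖R‖}

/-- `T` is regular: it is a linear combination of positive operators. -/
def IsRegularOp (T : E →L[𝕜] F) : Prop :=
  T ∈ Submodule.span 𝕜 {R : E →L[𝕜] F | IsPositiveOp R}

end Operators

/-- The measure `μ` is semi-finite: every measurable set of positive measure contains a measurable
set of finite positive measure. -/
def IsSemifiniteMeasure {A : Type*} [MeasurableSpace A] (μ : Measure A) : Prop :=
  ∀ s, MeasurableSet s → 0 < μ s → ∃ t ⊆ s, MeasurableSet t ∧ 0 < μ t ∧ μ t < ∞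

end

/-! Let `R` dominate `T`. A function `h` in `L^∞(A; Y)` can be written as a series `∑ 1_{s n} y n`
with `∑ 1_{s n} ‖y n‖ ≤ ‖h‖ + ε` at almost every point (`exists_indicator_series`). Positivity of
`R` gives `∑ |T 1_{s n}| ‖y n‖ ≤ (‖h‖ + ε) R 1` almost everywhere (`IsDominant.sum_norm_mul_le`).
Hence `∑ T 1_{s n} y n` converges absolutely at almost every point, to a function in `G(Y)` of norm
at most `(‖h‖ + ε) ‖R‖`. This is the value `T_Y h`.

For `x` in `X`, the identity `⟨x, T_Y h⟩ = T ⟨x, h⟩` says that `T` maps a boundedly convergent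
series of indicators to the pointwise series. It follows from dominated convergence on both sides of
`⟨S f, k⟩ = ⟨f, T k⟩` (`IsKoetheAdjoint.ae_eq_tsum`), and weak continuity of `T` enters through `S`.
As `X` separates the points of `Y`, these identities determine `T_Y h`. So `T_Y` is linear and
depends on neither the series, nor `ε`, nor `R`, and the bound `‖T_Y‖ ≤ ‖R‖` holds for every
dominant.

The dominant `R` need not have an adjoint into `L¹`, so a dominant of `S` is built as a modulus. For
`|g| ≤ |f|` one has `∫_s |S g| ≤ ⟨|f|, R 1_s⟩` (`IsKoetheAdjoint.setIntegral_norm_le`). The right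
side is additive in `s`, so finite suprema of the `|S g|` obey the same bound, and the supremum over
all such `g` exists in `L¹` (`exists_isLUB_lOne`). It is additive in `f ≥ 0`
(`isLUB_orderIntervalModuli_add`) and extends to a bounded operator (`exists_clm_of_nonneg`).

A dominant of `S` bounds `S ⊗ I_X` pointwise, via norming functionals
(`IsDominant.ae_norm_sum_smul_le`), so `S_X` exists. It is adjoint to `T_Y` on elementary tensors,
hence everywhere, and this makes `T_Y` weakly continuous. Conversely, a weakly continuous extension
of `T ⊗ I_Y` has adjoint `S f ⊗ x` on `f ⊗ x`, so it satisfies the identities that determine `T_Y`.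
-/

/-! ### Countable separating and norming families. -/

section Sequences

variable {𝕜 : Type*} [RCLike 𝕜] {X Y : Type*} [NormedAddCommGroup X] [NormedSpace 𝕜 X]
  [NormedAddCommGroup Y] [NormedSpace 𝕜 Y]

/-- If `X` separates the points of `Y`, then countably many elements of `X` separate the points
of a separable subset of `Y` from zero. -/
theorem exists_seq_apply_separating {β : X →L[𝕜] Y →L[𝕜] 𝕜} (hβ : Function.Injective β.flip)
    {s : Set Y} (hs : TopologicalSpace.IsSeparable s) :
    ∃ x : ℕ → X, ∀ y ∈ s, (∀ n, β (x n) y = 0) → y = 0 := by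
  have := hs.secondCountableTopology
  -- Lindelöf: the open sets where `β x` does not vanish have a countable subfamily with the same
  -- union.
  obtain ⟨x, hx⟩ := eq_open_union_nat (fun (x : X) => {y : s | β x y ≠ 0})
    (fun x => isOpen_ne_fun (by fun_prop) continuous_const)
  refine ⟨x, fun y hy h0 => hβ ?_⟩
  rw [map_zero]
  ext z
  by_contra hz
  have h1 : (⟨y, hy⟩ : s) ∈ ⋃ i, {y : s | β i y ≠ 0} := Set.mem_iUnion.2 ⟨z, hz⟩
  rw [← hx] at h1
  obtain ⟨n, hn⟩ := Set.mem_iUnion.1 h1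
  exact hn (h0 n)

/-- The exceptional null set depends on `x`, but `g` is almost everywhere separably valued, so
countably many `x` suffice. -/
theorem ae_eq_zero_of_forall_apply {β : X →L[𝕜] Y →L[𝕜] 𝕜} (hβ : Function.Injective β.flip)
    {B : Type*} [MeasurableSpace B] {ν : Measure B} {g : B → Y} (hg : AEStronglyMeasurable g ν)
    (h : ∀ x, ∀ᵐ b ∂ν, β x (g b) = 0) : ∀ᵐ b ∂ν, g b = 0 := by
  obtain ⟨t, ht, hgt⟩ := hg.isSeparable_ae_range
  obtain ⟨x, hx⟩ := exists_seq_apply_separating hβ ht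
  filter_upwards [hgt, ae_all_iff.2 fun n => h (x n)] with b h1 h2 using hx _ h1 h2

/-- A separable set is normed by a sequence of functionals in the unit ball of the dual. -/
theorem exists_seq_norming (𝕜 : Type*) [RCLike 𝕜] [NormedSpace 𝕜 X] {s : Set X}
    (hs : TopologicalSpace.IsSeparable s) :
    ∃ φ : ℕ → X →L[𝕜] 𝕜, (∀ n, ‖φ n‖ ≤ 1) ∧
      ∀ x ∈ s, ∀ c : ℝ, (∀ n, ‖φ n x‖ ≤ c) → ‖x‖ ≤ c := by
  obtain ⟨c, hc, hsc⟩ := hs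
  rcases c.eq_empty_or_nonempty with rfl | hne
  · refine ⟨0, by simp, fun x hx => ?_⟩
    simpa using hsc hx
  obtain ⟨d, rfl⟩ := hc.exists_eq_range hne
  choose φ hφ1 hφ2 using fun n => exists_dual_vector'' 𝕜 (d n)
  refine ⟨φ, hφ1, fun x hx c hxc => le_of_forall_pos_le_add fun ε hε => ?_⟩
  -- The distance to `d n` is paid twice, once in the norm and once under `φ n`; hence `ε / 2`.
  obtain ⟨_, ⟨n, rfl⟩, hn⟩ := Metric.mem_closure_iff.1 (hsc hx) (ε / 2) (half_pos hε)
  rw [dist_eq_norm] at hn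
  have h1 : ‖d n‖ = ‖φ n (d n)‖ := by rw [hφ2]; simp
  have h2 : ‖φ n (x - d n)‖ ≤ ‖x - d n‖ := by
    simpa using (φ n).le_of_opNorm_le (hφ1 n) (x - d n)
  have h3 : ‖φ n (d n)‖ ≤ ‖φ n x‖ + ‖φ n (x - d n)‖ := by
    rw [map_sub]
    have := norm_sub_le (φ n x) (φ n x - φ n (d n))
    simpa using this
  have h4 : ‖x‖ ≤ ‖d n‖ + ‖x - d n‖ := by
    simpa using norm_add_le (d n) (x - d n)
  linarith [hxc n]

end Sequences

/-! ### Moduli as suprema over unimodular scalars. -/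

section Sphere

variable {𝕜 : Type*} [RCLike 𝕜] {A : Type*} [MeasurableSpace A] {μ : Measure A}

instance nonempty_unitSphere : Nonempty (Metric.sphere (0 : 𝕜) 1) := ⟨⟨1, by simp⟩⟩

/-- An almost everywhere inequality that depends continuously on a unimodular scalar holds almost
everywhere for all unimodular scalars at once. -/
theorem ae_forall_unimodular {u : A → Metric.sphere (0 : 𝕜) 1 → ℝ} {c : A → ℝ}
    (hu : ∀ a, Continuous (u a)) (h : ∀ θ, ∀ᵐ a ∂μ, u a θ ≤ c a) :
    ∀ᵐ a ∂μ, ∀ θ, u a θ ≤ c a := by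
  filter_upwards [ae_all_iff.2 fun n => h (TopologicalSpace.denseSeq _ n)] with a ha θ
  exact (TopologicalSpace.denseRange_denseSeq _).induction_on θ
    (isClosed_le (hu a) continuous_const) ha

theorem exists_unimodular_mul (z : 𝕜) : ∃ θ : 𝕜, ‖θ‖ = 1 ∧ θ * z = ((‖z‖ : ℝ) : 𝕜) := by
  by_cases hz : z = 0
  · exact ⟨1, by simp [hz]⟩
  · have h0 : ((‖z‖ : ℝ) : 𝕜) ≠ 0 := by simpa using hz
    refine ⟨(‖z‖ : 𝕜) / z, ?_, ?_⟩
    · rw [norm_div]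
      simp [hz]
    · field_simp

/-- The modulus is the supremum of the real parts of the rotations. -/
theorem norm_le_of_forall_unimodular {z : 𝕜} {c : ℝ} (h : ∀ θ : 𝕜, ‖θ‖ = 1 → RCLike.re (θ * z) ≤ c) :
    ‖z‖ ≤ c := by
  obtain ⟨θ, h1, h2⟩ := exists_unimodular_mul z
  simpa [h2] using h θ h1

/-- A suitable rotation gives `w` the argument of `z`, and then the triangle inequality is an
equality. -/
theorem norm_add_norm_le_of_forall_unimodular {z w : 𝕜} {c : ℝ}
    (h : ∀ θ : 𝕜, ‖θ‖ = 1 → ‖z + θ * w‖ ≤ c) : ‖z‖ + ‖w‖ ≤ c := by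
  obtain ⟨θ, h1, h2⟩ := exists_unimodular_mul z
  obtain ⟨η, h3, h4⟩ := exists_unimodular_mul w
  have hθ : θ ≠ 0 := fun h0 => by simp [h0] at h1
  have := h (θ⁻¹ * η) (by simp [h1, h3])
  calc ‖z‖ + ‖w‖ = ‖((‖z‖ + ‖w‖ : ℝ) : 𝕜)‖ := by
        rw [RCLike.norm_ofReal, abs_of_nonneg (by positivity)]
    _ = ‖θ * (z + θ⁻¹ * η * w)‖ := by
        rw [mul_add, mul_assoc, mul_inv_cancel_left₀ hθ, h2, h4, RCLike.ofReal_add]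
    _ ≤ c := by rw [norm_mul, h1, one_mul]; exact this

end Sphere

/-! ### Weak continuity and adjoints. -/

section Weak

variable {𝕜 : Type*} [RCLike 𝕜] {V V' W W' : Type*} [AddCommGroup V] [Module 𝕜 V]
  [AddCommGroup V'] [Module 𝕜 V'] [AddCommGroup W] [Module 𝕜 W] [AddCommGroup W'] [Module 𝕜 W']
  {p : V →ₗ[𝕜] V' →ₗ[𝕜] 𝕜} {q : W →ₗ[𝕜] W' →ₗ[𝕜] 𝕜} {T : V →ₗ[𝕜] W}

theorem weakWeakContinuous_of_adjoint (h : ∀ w', ∃ v', ∀ v, q (T v) w' = p v v') :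
    WeakWeakContinuous p q T := by
  refine WeakBilin.continuous_of_continuous_eval q fun w' => ?_
  obtain ⟨v', hv⟩ := h w'
  have := WeakBilin.eval_continuous p v'
  exact this.congr fun v => (hv v).symm

/-- The functional `q (T ·) w'` is `σ(V, V')`-continuous, and every such functional is given by an
element of `V'`. -/
theorem WeakWeakContinuous.exists_adjoint (h : WeakWeakContinuous p q T) (w' : W') :
    ∃ v', ∀ v, q (T v) w' = p v v' := by
  let φ : WeakBilin p →L[𝕜] 𝕜 :=
    ⟨(q.flip w').comp T, (WeakBilin.eval_continuous q w').comp h⟩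
  obtain ⟨v', hv⟩ := LinearMap.dualEmbedding_surjective p φ
  exact ⟨v', fun v => (DFunLike.congr_fun hv v).symm⟩

end Weak

/-! ### Bounded functions and `L^∞`. -/

section LInfty

variable {A : Type*} [MeasurableSpace A] {μ : Measure A} {Y : Type*} [NormedAddCommGroup Y]

/-- The class in `L^∞` of a bounded strongly measurable function. -/
noncomputable def bddLp (f : A → Y) (hf : AEStronglyMeasurable f μ) (C : ℝ) (hC : ∀ a, ‖f a‖ ≤ C) :
    Lp Y ∞ μ :=
  (memLp_top_of_bound hf C (ae_of_all _ hC)).toLp f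

theorem coeFn_bddLp (f : A → Y) (hf : AEStronglyMeasurable f μ) (C : ℝ) (hC : ∀ a, ‖f a‖ ≤ C) :
    ∀ᵐ a ∂μ, bddLp f hf C hC a = f a :=
  MemLp.coeFn_toLp _

theorem norm_lInfty_le_of_ae_le (f : Lp Y ∞ μ) {C : ℝ} (h0 : 0 ≤ C) (hC : ∀ᵐ a ∂μ, ‖f a‖ ≤ C) :
    ‖f‖ ≤ C := by
  rw [Lp.norm_def]
  refine ENNReal.toReal_le_of_le_ofReal h0 ?_
  rw [eLpNorm_exponent_top]
  exact eLpNormEssSup_le_of_ae_bound hC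

theorem norm_bddLp_le (f : A → Y) (hf : AEStronglyMeasurable f μ) {C : ℝ} (hC : ∀ a, ‖f a‖ ≤ C)
    (h0 : 0 ≤ C) : ‖bddLp f hf C hC‖ ≤ C :=
  norm_lInfty_le_of_ae_le _ h0 ((coeFn_bddLp f hf C hC).mono fun a ha => by rw [ha]; exact hC a)

theorem ae_norm_le_norm_lInfty (f : Lp Y ∞ μ) : ∀ᵐ a ∂μ, ‖f a‖ ≤ ‖f‖ := by
  filter_upwards [enorm_ae_le_eLpNormEssSup f μ] with a ha
  rw [Lp.norm_def, eLpNorm_exponent_top, ← toReal_enorm]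
  refine ENNReal.toReal_mono ?_ ha
  rw [← eLpNorm_exponent_top]
  exact Lp.eLpNorm_ne_top f

end LInfty

/-! ### Duality of `L¹` and `L^∞`. -/

section LOne

variable {𝕜 : Type*} [RCLike 𝕜] {A : Type*} [MeasurableSpace A] {μ : Measure A}

/-- The sign is `conj u / |u|`; the convention `0 / 0 = 0` makes it vanish where `u` does. -/
theorem exists_sign_lOne (u : Lp 𝕜 1 μ) :
    ∃ h : Lp 𝕜 ∞ μ, ‖h‖ ≤ 1 ∧ (∀ᵐ a ∂μ, ‖h a‖ ≤ 1) ∧ ∀ᵐ a ∂μ, u a * h a = ((‖u a‖ : ℝ) : 𝕜) := by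
  have hm : AEStronglyMeasurable (fun a => starRingEnd 𝕜 (u a) / ((‖u a‖ : ℝ) : 𝕜)) μ := by
    have := (Lp.aestronglyMeasurable u).aemeasurable
    refine AEMeasurable.aestronglyMeasurable (AEMeasurable.div ?_ ?_)
    · exact (RCLike.continuous_conj.measurable).comp_aemeasurable this
    · exact (RCLike.continuous_ofReal.measurable).comp_aemeasurable this.norm
  have hb : ∀ a, ‖starRingEnd 𝕜 (u a) / ((‖u a‖ : ℝ) : 𝕜)‖ ≤ 1 := fun a => by
    rw [norm_div, RCLike.norm_conj]
    simpa using div_self_le_one _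
  refine ⟨bddLp _ hm 1 hb, norm_bddLp_le _ _ hb zero_le_one, ?_, ?_⟩
  · filter_upwards [coeFn_bddLp _ hm 1 hb] with a ha
    rw [ha]; exact hb a
  · filter_upwards [coeFn_bddLp _ hm 1 hb] with a ha
    rw [ha, ← mul_div_assoc, RCLike.mul_conj, sq, mul_div_assoc]
    by_cases h : ((‖u a‖ : ℝ) : 𝕜) = 0
    · simp [h]
    · rw [div_self h, mul_one]

theorem exists_pairing_eq_norm (u : Lp 𝕜 1 μ) :
    ∃ h : Lp 𝕜 ∞ μ, ‖h‖ ≤ 1 ∧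
      lOneLInftyPairing μ (ContinuousLinearMap.mul 𝕜 𝕜) u h = ((‖u‖ : ℝ) : 𝕜) := by
  obtain ⟨h, h1, -, h2⟩ := exists_sign_lOne u
  refine ⟨h, h1, ?_⟩
  rw [lOneLInftyPairing_apply, L1.norm_eq_integral_norm, ← integral_ofReal]
  refine integral_congr_ae (h2.mono fun a ha => ?_)
  simpa using ha

theorem lOne_eq_zero_of_pairing {u : Lp 𝕜 1 μ}
    (hu : ∀ h, lOneLInftyPairing μ (ContinuousLinearMap.mul 𝕜 𝕜) u h = 0) : u = 0 := by
  obtain ⟨h, -, hh⟩ := exists_pairing_eq_norm u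
  rw [hu] at hh
  simpa using hh.symm

variable {X Y : Type*} [NormedAddCommGroup X] [NormedSpace 𝕜 X]
  [NormedAddCommGroup Y] [NormedSpace 𝕜 Y] (β : X →L[𝕜] Y →L[𝕜] 𝕜)

theorem lOneLInftyPairing_smul_right (u : Lp X 1 μ) (h : Lp 𝕜 ∞ μ) (y : Y) :
    lOneLInftyPairing μ β u ((ContinuousLinearMap.toSpanSingleton 𝕜 y).compLp h) =
      lOneLInftyPairing μ (ContinuousLinearMap.mul 𝕜 𝕜) ((β.flip y).compLp u) h := by
  rw [lOneLInftyPairing_apply, lOneLInftyPairing_apply]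
  refine integral_congr_ae ?_
  filter_upwards [(ContinuousLinearMap.toSpanSingleton 𝕜 y).coeFn_compLp h,
    (β.flip y).coeFn_compLp u] with a h1 h2
  simp [h1, h2, mul_comm]

theorem lOneLInftyPairing_smul_left (u : Lp 𝕜 1 μ) (h : Lp Y ∞ μ) (x : X) :
    lOneLInftyPairing μ β ((ContinuousLinearMap.toSpanSingleton 𝕜 x).compLp u) h =
      lOneLInftyPairing μ (ContinuousLinearMap.mul 𝕜 𝕜) u ((β x).compLp h) := by
  rw [lOneLInftyPairing_apply, lOneLInftyPairing_apply]
  refine integral_congr_ae ?_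
  filter_upwards [(ContinuousLinearMap.toSpanSingleton 𝕜 x).coeFn_compLp u,
    (β x).coeFn_compLp h] with a h1 h2
  simp [h1, h2]

variable {β}

/-- For fixed `y` the scalar function `⟨u, y⟩` is annihilated by `L^∞`, hence zero, and `Y`
separates the points of `X`. -/
theorem lOne_eq_zero_of_pairing_smul (hβ : Function.Injective β) {u : Lp X 1 μ}
    (hu : ∀ (h : Lp 𝕜 ∞ μ) (y : Y),
      lOneLInftyPairing μ β u ((ContinuousLinearMap.toSpanSingleton 𝕜 y).compLp h) = 0) :
    u = 0 := by
  refine (Lp.eq_zero_iff_ae_eq_zero).2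
    (ae_eq_zero_of_forall_apply (β := β.flip) hβ (Lp.aestronglyMeasurable u) fun y => ?_)
  have : (β.flip y).compLp u = 0 :=
    lOne_eq_zero_of_pairing fun h => by rw [← lOneLInftyPairing_smul_right]; exact hu h y
  filter_upwards [(β.flip y).coeFn_compLp u, (Lp.eq_zero_iff_ae_eq_zero).1 this] with a h1 h2
  rw [← h1, h2]; rfl

end LOne

/-! ### The scalar adjoint `S`. -/

section Adjoint

variable {𝕜 : Type*} [RCLike 𝕜] {A : Type*} [MeasurableSpace A] {μ : Measure A}
  {B : Type*} [MeasurableSpace B] {ν : Measure B} {F G : BanachFunctionSpace 𝕜 ν}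

/-- `S : F → L¹(A)` is the adjoint of `T : L^∞(A) → G`. -/
def IsKoetheAdjoint (hFG : IsKoetheDualPair F G) (T : Lp 𝕜 ∞ μ →L[𝕜] G.carrier)
    (S : F.carrier →L[𝕜] Lp 𝕜 1 μ) : Prop :=
  ∀ (f : F.carrier) (h : Lp 𝕜 ∞ μ),
    lOneLInftyPairing μ (ContinuousLinearMap.mul 𝕜 𝕜) (S f) h = hFG.pairing f (T h)

theorem IsKoetheAdjoint.unique {hFG : IsKoetheDualPair F G} {T : Lp 𝕜 ∞ μ →L[𝕜] G.carrier}
    {S S' : F.carrier →L[𝕜] Lp 𝕜 1 μ} (h : IsKoetheAdjoint hFG T S)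
    (h' : IsKoetheAdjoint hFG T S') : S = S' := by
  ext1 f
  refine sub_eq_zero.1 (lOne_eq_zero_of_pairing fun k => ?_)
  rw [map_sub, LinearMap.sub_apply, h f k, h' f k, sub_self]

/-- The values `S f` come from weak continuity one at a time. They are linear in `f` because `L^∞`
separates `L¹`, and bounded because pairing with a sign function recovers the `L¹` norm. -/
theorem exists_isKoetheAdjoint (hFG : IsKoetheDualPair F G) (T : Lp 𝕜 ∞ μ →L[𝕜] G.carrier)
    (hT : WeakWeakContinuous (lOneLInftyPairing μ (ContinuousLinearMap.mul 𝕜 𝕜)).flip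
      hFG.pairing.flip T.toLinearMap) : ∃ S, IsKoetheAdjoint hFG T S := by
  choose S hS using hT.exists_adjoint
  replace hS : ∀ f h, lOneLInftyPairing μ (ContinuousLinearMap.mul 𝕜 𝕜) (S f) h =
    hFG.pairing f (T h) := fun f h => (hS f h).symm
  obtain ⟨C, hC⟩ := hFG.bounded
  let L : F.carrier →ₗ[𝕜] Lp 𝕜 1 μ :=
    { toFun := S
      map_add' := fun f g => sub_eq_zero.1 (lOne_eq_zero_of_pairing fun k => by
        rw [map_sub, LinearMap.sub_apply, map_add, LinearMap.add_apply, hS, hS, hS, map_add,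
          LinearMap.add_apply, sub_self])
      map_smul' := fun c f => sub_eq_zero.1 (lOne_eq_zero_of_pairing fun k => by
        rw [RingHom.id_apply, map_sub, LinearMap.sub_apply, map_smul, LinearMap.smul_apply, hS, hS,
          map_smul, LinearMap.smul_apply, sub_self]) }
  refine ⟨L.mkContinuous (max C 0 * ‖T‖) fun f => ?_, hS⟩
  obtain ⟨h, h1, h2⟩ := exists_pairing_eq_norm (S f)
  rw [hS] at h2
  calc ‖S f‖ = ‖hFG.pairing f (T h)‖ := by rw [h2]; simp
    _ ≤ C * ‖f‖ * ‖T h‖ := hC f (T h)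
    _ ≤ max C 0 * ‖f‖ * (‖T‖ * 1) := by
        have := T.le_opNorm_of_le h1
        gcongr
        exact le_max_left _ _
    _ = max C 0 * ‖T‖ * ‖f‖ := by ring

end Adjoint

/-! ### Bounded functions as series of indicators. -/

section Representation

variable {A : Type*} [MeasurableSpace A] {Y : Type*} [NormedAddCommGroup Y]

/-- A strongly measurable function is uniformly approximated by countably valued functions. -/
theorem exists_countably_valued_approx {h : A → Y} (hh : StronglyMeasurable h) :
    ∃ d : ℕ → Y, ∀ δ > 0, ∃ k : A → ℕ, Measurable k ∧ ∀ a, ‖h a - d (k a)‖ < δ := by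
  classical
  obtain ⟨c, hc, hsc⟩ := hh.isSeparable_range
  rcases isEmpty_or_nonempty A with hA | ⟨⟨a₀⟩⟩
  · exact ⟨0, fun δ _ => ⟨isEmptyElim, measurable_of_empty _, fun a => isEmptyElim a⟩⟩
  have hne : c.Nonempty := closure_nonempty_iff.1 ⟨_, hsc (Set.mem_range_self a₀)⟩
  obtain ⟨d, rfl⟩ := hc.exists_eq_range hne
  refine ⟨d, fun δ hδ => ?_⟩
  have hex : ∀ a, ∃ n, ‖h a - d n‖ < δ := fun a => by
    obtain ⟨_, ⟨n, rfl⟩, hn⟩ := Metric.mem_closure_iff.1 (hsc (Set.mem_range_self a)) δ hδ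
    exact ⟨n, by rwa [dist_eq_norm] at hn⟩
  -- Taking the least admissible index makes the choice measurable.
  refine ⟨fun a => Nat.find (hex a), measurable_find hex fun n => ?_,
    fun a => Nat.find_spec (hex a)⟩
  exact (hh.sub stronglyMeasurable_const).norm.measurableSet_lt stronglyMeasurable_const

/-- Each `c j` takes the value `e j i` on the level set `{m j = i}`, and `Nat.pair` enumerates all
`(j, i)` in one series. At a point `a` only the indices `(j, m j a)` contribute, one for each `j`,
so neither the sum nor the sum of norms changes. -/
theorem exists_indicator_series_of_levels {c : ℕ → A → Y} {h : A → Y} {C : ℝ}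
    (e : ℕ → ℕ → Y) (m : ℕ → A → ℕ) (hm : ∀ j, Measurable (m j)) (hc : ∀ j a, c j a = e j (m j a))
    (hs : ∀ a, HasSum (fun j => c j a) (h a)) (hn : ∀ a, Summable fun j => ‖c j a‖)
    (hC : ∀ a, ∑' j, ‖c j a‖ ≤ C) :
    ∃ (s : ℕ → Set A) (y : ℕ → Y), (∀ n, MeasurableSet (s n)) ∧ ∀ a,
      HasSum (fun n => (s n).indicator (fun _ => y n) a) (h a) ∧
      (∀ N, ∑ n ∈ Finset.range N, (s n).indicator (fun _ => ‖y n‖) a ≤ C) := by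
  classical
  refine ⟨fun n => m n.unpair.1 ⁻¹' {n.unpair.2}, fun n => e n.unpair.1 n.unpair.2,
    fun n => hm _ (measurableSet_singleton _), fun a => ?_⟩
  have hinj : Function.Injective (fun j => Nat.pair j (m j a)) := fun i j hij => by
    have := congrArg (fun n => n.unpair.1) hij
    simpa using this
  have hz : ∀ n : ℕ, n ∉ Set.range (fun j => Nat.pair j (m j a)) →
      a ∉ m n.unpair.1 ⁻¹' {n.unpair.2} := by
    refine fun n hn hmem => hn ⟨n.unpair.1, ?_⟩
    have : m n.unpair.1 a = n.unpair.2 := hmem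
    simp [this]
  constructor
  · rw [← hinj.hasSum_iff fun n hn => Set.indicator_of_notMem (hz n hn) _]
    convert hs a using 2 with j
    simp [hc]
  · intro N
    have h1 : HasSum (fun n : ℕ => (m n.unpair.1 ⁻¹' {n.unpair.2}).indicator
        (fun _ => ‖e n.unpair.1 n.unpair.2‖) a) (∑' j, ‖c j a‖) := by
      rw [← hinj.hasSum_iff fun n hn => Set.indicator_of_notMem (hz n hn) _]
      convert (hn a).hasSum using 2 with j
      simp [hc]
    refine (sum_le_hasSum _ (fun n _ => ?_) h1).trans (hC a)
    exact Set.indicator_nonneg (fun _ _ => norm_nonneg _) _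

/-- A bounded strongly measurable function is the sum of a series of functions `1_{s n} • y n`
whose norms add up to little more than the bound. -/
theorem exists_indicator_series [CompleteSpace Y] {h : A → Y} (hh : StronglyMeasurable h) {M : ℝ}
    (hM : ∀ a, ‖h a‖ ≤ M) {ε : ℝ} (hε : 0 < ε) :
    ∃ (s : ℕ → Set A) (y : ℕ → Y), (∀ n, MeasurableSet (s n)) ∧ ∀ a,
      HasSum (fun n => (s n).indicator (fun _ => y n) a) (h a) ∧
      (∀ N, ∑ n ∈ Finset.range N, (s n).indicator (fun _ => ‖y n‖) a ≤ M + ε) := by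
  obtain ⟨d, hd⟩ := exists_countably_valued_approx hh
  -- The telescoping series below starts with a term of norm at most `M + ε / 5`. Its differences
  -- have norm at most `2 * (ε / 5) * 2⁻ʲ`, which adds up to `4 * ε / 5`; the total is `M + ε`.
  choose k hkm hk using fun j : ℕ => hd (ε / 5 * (1 / 2) ^ j) (by positivity)
  let c : ℕ → A → Y := fun j a => Nat.casesOn j (d (k 0 a)) fun j => d (k (j + 1) a) - d (k j a)
  let u : ℕ → ℝ := fun j => Nat.casesOn j (M + ε / 5) fun j => 2 * ε / 5 * (1 / 2) ^ j
  have hcu : ∀ a j, ‖c j a‖ ≤ u j := by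
    rintro a (_ | j)
    · have h1 := hk 0 a
      have h2 : ‖d (k 0 a)‖ ≤ ‖h a‖ + ‖h a - d (k 0 a)‖ := by
        simpa using norm_sub_le (h a) (h a - d (k 0 a))
      simp only [pow_zero, mul_one] at h1
      change ‖d (k 0 a)‖ ≤ M + ε / 5
      linarith [hM a]
    · change ‖d (k (j + 1) a) - d (k j a)‖ ≤ 2 * ε / 5 * (1 / 2) ^ j
      have h1 := hk j a
      have h2 := hk (j + 1) a
      have h3 : ‖d (k (j + 1) a) - d (k j a)‖ ≤ ‖h a - d (k j a)‖ + ‖h a - d (k (j + 1) a)‖ := by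
        simpa using norm_sub_le (h a - d (k j a)) (h a - d (k (j + 1) a))
      have h4 : ε / 5 * (1 / 2 : ℝ) ^ (j + 1) ≤ ε / 5 * (1 / 2) ^ j :=
        mul_le_mul_of_nonneg_left
          (pow_le_pow_of_le_one (by norm_num) (by norm_num) (Nat.le_succ j)) (by positivity)
      have h5 : 2 * ε / 5 * (1 / 2 : ℝ) ^ j = ε / 5 * (1 / 2) ^ j + ε / 5 * (1 / 2) ^ j := by ring
      linarith
  have hu : HasSum u (M + ε) := by
    rw [← hasSum_nat_add_iff' 1]
    have := (hasSum_geometric_two).mul_left (2 * ε / 5)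
    have h2 : M + ε - ∑ i ∈ Finset.range 1, u i = 2 * ε / 5 * 2 := by
      rw [Finset.sum_range_one]
      change M + ε - (M + ε / 5) = _
      ring
    rw [h2]
    exact this
  have hn : ∀ a, Summable fun j => ‖c j a‖ := fun a =>
    hu.summable.of_nonneg_of_le (fun _ => norm_nonneg _) (hcu a)
  -- A difference is determined by two indices, so its level is coded by their pair; the initial
  -- term uses a dummy first index `0`.
  refine exists_indicator_series_of_levels (c := c)
    (fun j n => Nat.casesOn j (d n.unpair.2) fun _ => d n.unpair.1 - d n.unpair.2)
    (fun j a => Nat.casesOn j (Nat.pair 0 (k 0 a)) fun j => Nat.pair (k (j + 1) a) (k j a))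
    ?_ ?_ ?_ hn ?_
  · have hp : Measurable (Function.uncurry Nat.pair) := measurable_of_countable _
    rintro (_ | j)
    · exact hp.comp (measurable_const.prodMk (hkm 0))
    · exact hp.comp ((hkm (j + 1)).prodMk (hkm j))
  · rintro (_ | j) a <;> simp [c]
  · intro a
    -- The shift by one is due to the initial term: `n + 1` terms telescope to `d (k n a)`.
    rw [(hn a).of_norm.hasSum_iff_tendsto_nat, ← tendsto_add_atTop_iff_nat 1]
    have h1 : ∀ n, ∑ j ∈ Finset.range (n + 1), c j a = d (k n a) := by
      intro n
      rw [Finset.sum_range_succ']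
      simp only [c]
      rw [Finset.sum_range_sub (fun j => d (k j a))]
      simp
    simp_rw [h1]
    rw [tendsto_iff_norm_sub_tendsto_zero]
    have h2 : Tendsto (fun n : ℕ => ε / 5 * (1 / 2 : ℝ) ^ n) atTop (𝓝 0) := by
      simpa using (tendsto_pow_atTop_nhds_zero_of_lt_one (r := (1 / 2 : ℝ)) (by norm_num)
        (by norm_num)).const_mul (ε / 5)
    exact squeeze_zero (fun _ => norm_nonneg _)
      (fun n => by rw [norm_sub_rev]; exact (hk n a).le) h2
  · intro a
    exact hasSum_le (hcu a) (hn a).hasSum hu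

end Representation

/-! ### Pointwise calculus in `E` and `E(Y)`. -/

section FunctionSpace

variable {𝕜 : Type*} [RCLike 𝕜] {B : Type*} [MeasurableSpace B] {ν : Measure B}
  (E : BanachFunctionSpace 𝕜 ν) {X Y : Type*} [NormedAddCommGroup X] [NormedSpace 𝕜 X]
  [NormedAddCommGroup Y] [NormedSpace 𝕜 Y]

namespace BanachFunctionSpace

/-- This is how functions defined by pointwise formulas enter `E`: solidity gives membership, and
monotonicity of the norm gives the bound. -/
theorem exists_ae_eq {f : B → 𝕜} (hf : AEStronglyMeasurable f ν) (g : E.carrier)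
    (hfg : ∀ᵐ b ∂ν, ‖f b‖ ≤ ‖(g : B →ₘ[ν] 𝕜) b‖) :
    ∃ φ : E.carrier, (∀ᵐ b ∂ν, (φ : B →ₘ[ν] 𝕜) b = f b) ∧ ‖φ‖ ≤ ‖g‖ := by
  have h := AEEqFun.coeFn_mk f hf
  have h1 : ∀ᵐ b ∂ν, ‖AEEqFun.mk f hf b‖ ≤ ‖(g : B →ₘ[ν] 𝕜) b‖ := by
    filter_upwards [h, hfg] with b h1 h2
    rwa [h1]
  exact ⟨⟨AEEqFun.mk f hf, E.mem_of_norm_le g.2 h1⟩, h, E.mono _ g h1⟩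

theorem exists_bochner_ae_eq {f : B → Y} (hf : AEStronglyMeasurable f ν) (g : E.carrier)
    (hfg : ∀ᵐ b ∂ν, ‖f b‖ ≤ ‖(g : B →ₘ[ν] 𝕜) b‖) :
    ∃ φ : E.Bochner Y, (∀ᵐ b ∂ν, (φ : B →ₘ[ν] Y) b = f b) ∧ ‖φ‖ ≤ ‖g‖ := by
  have h := AEEqFun.coeFn_mk f hf
  have h1 : ∀ᵐ b ∂ν, ‖normFun 𝕜 (AEEqFun.mk f hf) b‖ ≤ ‖(g : B →ₘ[ν] 𝕜) b‖ := by
    filter_upwards [h, hfg, coeFn_normFun (𝕜 := 𝕜) (AEEqFun.mk f hf)] with b h1 h2 h3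
    rw [h3, h1]
    simpa using h2
  exact ⟨⟨AEEqFun.mk f hf, E.mem_of_norm_le g.2 h1⟩, h, E.mono (Bochner.normElt _) g h1⟩

variable {E}

theorem ext_ae {f g : E.carrier} (h : ∀ᵐ b ∂ν, (f : B →ₘ[ν] 𝕜) b = (g : B →ₘ[ν] 𝕜) b) : f = g :=
  Subtype.ext (AEEqFun.ext h)

theorem Bochner.ext_ae {f g : E.Bochner Y}
    (h : ∀ᵐ b ∂ν, (f : B →ₘ[ν] Y) b = (g : B →ₘ[ν] Y) b) : f = g :=
  Bochner.ext (AEEqFun.ext h)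

theorem coeFn_add (f g : E.carrier) : ∀ᵐ b ∂ν, ((f + g : E.carrier) : B →ₘ[ν] 𝕜) b =
    (f : B →ₘ[ν] 𝕜) b + (g : B →ₘ[ν] 𝕜) b :=
  AEEqFun.coeFn_add (f : B →ₘ[ν] 𝕜) g

theorem coeFn_sub (f g : E.carrier) : ∀ᵐ b ∂ν, ((f - g : E.carrier) : B →ₘ[ν] 𝕜) b =
    (f : B →ₘ[ν] 𝕜) b - (g : B →ₘ[ν] 𝕜) b :=
  AEEqFun.coeFn_sub (f : B →ₘ[ν] 𝕜) g

theorem coeFn_smul (c : 𝕜) (f : E.carrier) : ∀ᵐ b ∂ν, ((c • f : E.carrier) : B →ₘ[ν] 𝕜) b =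
    c * (f : B →ₘ[ν] 𝕜) b :=
  AEEqFun.coeFn_smul c (f : B →ₘ[ν] 𝕜)

theorem coeFn_zero : ∀ᵐ b ∂ν, ((0 : E.carrier) : B →ₘ[ν] 𝕜) b = 0 :=
  AEEqFun.coeFn_zero (μ := ν) (β := 𝕜)

theorem coeFn_sum {ι : Type*} (s : Finset ι) (f : ι → E.carrier) :
    ∀ᵐ b ∂ν, ((∑ i ∈ s, f i : E.carrier) : B →ₘ[ν] 𝕜) b = ∑ i ∈ s, (f i : B →ₘ[ν] 𝕜) b := by
  classical
  induction s using Finset.induction_on with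
  | empty => simpa using coeFn_zero (E := E)
  | insert i s hi ih =>
    filter_upwards [ih, coeFn_add (f i) (∑ j ∈ s, f j)] with b h1 h2
    rw [Finset.sum_insert hi, Finset.sum_insert hi, h2, h1]

namespace Bochner

theorem coeFn_add (f g : E.Bochner Y) : ∀ᵐ b ∂ν, ((f + g : E.Bochner Y) : B →ₘ[ν] Y) b =
    (f : B →ₘ[ν] Y) b + (g : B →ₘ[ν] Y) b :=
  AEEqFun.coeFn_add (f : B →ₘ[ν] Y) g

theorem coeFn_sub (f g : E.Bochner Y) : ∀ᵐ b ∂ν, ((f - g : E.Bochner Y) : B →ₘ[ν] Y) b =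
    (f : B →ₘ[ν] Y) b - (g : B →ₘ[ν] Y) b :=
  AEEqFun.coeFn_sub (f : B →ₘ[ν] Y) g

theorem coeFn_smul (c : 𝕜) (f : E.Bochner Y) : ∀ᵐ b ∂ν, ((c • f : E.Bochner Y) : B →ₘ[ν] Y) b =
    c • (f : B →ₘ[ν] Y) b :=
  AEEqFun.coeFn_smul c (f : B →ₘ[ν] Y)

theorem coeFn_tensor (f : E.carrier) (y : Y) :
    ∀ᵐ b ∂ν, (tensor f y : B →ₘ[ν] Y) b = (f : B →ₘ[ν] 𝕜) b • y :=
  coeFn_elemTensor (f : B →ₘ[ν] 𝕜) y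

/-- Scalarly equal functions are equal. -/
theorem ext_apply {β : X →L[𝕜] Y →L[𝕜] 𝕜} (hβ : Function.Injective β.flip) {g g' : E.Bochner Y}
    (h : ∀ x, ∀ᵐ b ∂ν, β x ((g : B →ₘ[ν] Y) b) = β x ((g' : B →ₘ[ν] Y) b)) : g = g' := by
  refine ext_ae ?_
  have := ae_eq_zero_of_forall_apply (ν := ν) hβ
    (g := fun b => (g : B →ₘ[ν] Y) b - (g' : B →ₘ[ν] Y) b)
    ((AEEqFun.aestronglyMeasurable _).sub (AEEqFun.aestronglyMeasurable _)) (fun x => by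
      filter_upwards [h x] with b hb
      rw [map_sub, hb, sub_self])
  exact this.mono fun b hb => sub_eq_zero.1 hb

theorem exists_apply_ae_eq (ψ : Y →L[𝕜] 𝕜) (g : E.Bochner Y) :
    ∃ γ : E.carrier, ∀ᵐ b ∂ν, (γ : B →ₘ[ν] 𝕜) b = ψ ((g : B →ₘ[ν] Y) b) := by
  obtain ⟨γ, h, -⟩ := E.exists_ae_eq (f := fun b => ψ ((g : B →ₘ[ν] Y) b))
    (ψ.continuous.comp_aestronglyMeasurable (AEEqFun.aestronglyMeasurable _))
    (((‖ψ‖ : ℝ) : 𝕜) • normElt g) (by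
      filter_upwards [BanachFunctionSpace.coeFn_smul ((‖ψ‖ : ℝ) : 𝕜) (normElt g),
        coeFn_normElt g] with b h1 h2
      rw [h1, h2]
      simpa using ψ.le_opNorm _)
  exact ⟨γ, h⟩

end Bochner

end BanachFunctionSpace

end FunctionSpace

/-! ### The `Y`-valued extension of `T`. -/

section ValuedExtension

variable {𝕜 : Type*} [RCLike 𝕜] {A : Type*} [MeasurableSpace A] {μ : Measure A}
  {B : Type*} [MeasurableSpace B] {ν : Measure B} {F G : BanachFunctionSpace 𝕜 ν}
  {X Y : Type*} [NormedAddCommGroup X] [NormedSpace 𝕜 X] [NormedAddCommGroup Y] [NormedSpace 𝕜 Y]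

/-- The class of the indicator function of a measurable set in `L^∞`. -/
noncomputable def indLp (𝕜 : Type*) [RCLike 𝕜] (μ : Measure A) {s : Set A} (hs : MeasurableSet s) :
    Lp 𝕜 ∞ μ :=
  bddLp (s.indicator fun _ => (1 : 𝕜)) ((stronglyMeasurable_const.indicator hs).aestronglyMeasurable)
    1 fun a => by
      by_cases h : a ∈ s <;> simp [h]

theorem coeFn_indLp {s : Set A} (hs : MeasurableSet s) :
    ∀ᵐ a ∂μ, indLp 𝕜 μ hs a = s.indicator (fun _ => (1 : 𝕜)) a :=
  coeFn_bddLp _ _ _ _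

theorem norm_indLp_le {s : Set A} (hs : MeasurableSet s) : ‖indLp 𝕜 μ hs‖ ≤ 1 :=
  norm_bddLp_le _ _ _ zero_le_one

theorem coeFn_sum_smul_indLp {s : ℕ → Set A} (hs : ∀ n, MeasurableSet (s n)) (c : ℕ → 𝕜) (N : ℕ) :
    ∀ᵐ a ∂μ, (∑ n ∈ Finset.range N, c n • indLp 𝕜 μ (hs n) : Lp 𝕜 ∞ μ) a =
      ∑ n ∈ Finset.range N, (s n).indicator (fun _ => c n) a := by
  filter_upwards [Lp.coeFn_finsetSum (Finset.range N) fun n => c n • indLp 𝕜 μ (hs n),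
    ae_all_iff.2 fun n => Lp.coeFn_smul (c n) (indLp 𝕜 μ (hs n)),
    ae_all_iff.2 fun n => coeFn_indLp (𝕜 := 𝕜) (μ := μ) (hs n)] with a h1 h2 h3
  rw [h1, Finset.sum_apply]
  refine Finset.sum_congr rfl fun n _ => ?_
  rw [h2, Pi.smul_apply, h3]
  by_cases h : a ∈ s n <;> simp [h]

/-- If the functions `c n • 1_{s n}` have sum at most `C`, then the functions `c n • |T 1_{s n}|`
have sum at most `C • R 1`. -/
theorem IsDominant.sum_norm_mul_le {T R : Lp 𝕜 ∞ μ →L[𝕜] G.carrier} (hR : IsDominant T R)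
    {s : ℕ → Set A} (hs : ∀ n, MeasurableSet (s n)) {c : ℕ → ℝ} (hc : ∀ n, 0 ≤ c n) {C : ℝ}
    (hC : ∀ a N, ∑ n ∈ Finset.range N, (s n).indicator (fun _ => c n) a ≤ C) :
    ∀ᵐ b ∂ν, ∀ N, ∑ n ∈ Finset.range N, ‖(T (indLp 𝕜 μ (hs n)) : B →ₘ[ν] 𝕜) b‖ * c n ≤
      ‖(((C : 𝕜) • R (indLp 𝕜 μ MeasurableSet.univ) : G.carrier) : B →ₘ[ν] 𝕜) b‖ := by
  refine ae_all_iff.2 fun N => ?_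
  -- The bound on the sums says that this function is nonnegative, so `R e ≥ 0`; together with `|T
  -- 1_{s n}| ≤ R 1_{s n}` this is the claim.
  set e : Lp 𝕜 ∞ μ := (C : 𝕜) • indLp 𝕜 μ MeasurableSet.univ -
    ∑ n ∈ Finset.range N, (c n : 𝕜) • indLp 𝕜 μ (hs n) with he
  have he0 : ∀ᵐ a ∂μ, 0 ≤ (e : A →ₘ[μ] 𝕜) a := by
    filter_upwards [Lp.coeFn_sub ((C : 𝕜) • indLp 𝕜 μ MeasurableSet.univ)
      (∑ n ∈ Finset.range N, (c n : 𝕜) • indLp 𝕜 μ (hs n)),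
      Lp.coeFn_smul (C : 𝕜) (indLp 𝕜 μ MeasurableSet.univ),
      coeFn_indLp (𝕜 := 𝕜) (μ := μ) MeasurableSet.univ,
      coeFn_sum_smul_indLp (μ := μ) hs (fun n => (c n : 𝕜)) N] with a h1 h2 h3 h4
    rw [he, h1, Pi.sub_apply, h2, Pi.smul_apply, h3, h4, sub_nonneg]
    have h5 : ∑ n ∈ Finset.range N, (s n).indicator (fun _ => (c n : 𝕜)) a =
        ((∑ n ∈ Finset.range N, (s n).indicator (fun _ => c n) a : ℝ) : 𝕜) := by
      rw [RCLike.ofReal_sum]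
      refine Finset.sum_congr rfl fun n _ => ?_
      by_cases h : a ∈ s n <;> simp [h]
    rw [h5, Set.indicator_univ, smul_eq_mul, mul_one]
    exact RCLike.ofReal_le_ofReal.2 (hC a N)
  have hn : ∀ n, ∀ᵐ b ∂ν, ((‖(T (indLp 𝕜 μ (hs n)) : B →ₘ[ν] 𝕜) b‖ : ℝ) : 𝕜) ≤
      (R (indLp 𝕜 μ (hs n)) : B →ₘ[ν] 𝕜) b := fun n => by
    refine hR.2 _ _ ?_
    filter_upwards [coeFn_indLp (𝕜 := 𝕜) (μ := μ) (hs n)] with a ha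
    rw [ha]
    by_cases h : a ∈ s n <;> simp [h]
  have hRe : R e = (C : 𝕜) • R (indLp 𝕜 μ MeasurableSet.univ) -
      ∑ n ∈ Finset.range N, (c n : 𝕜) • R (indLp 𝕜 μ (hs n)) := by
    rw [he, map_sub, map_sum, map_smul]
    simp_rw [map_smul]
  have hRe0 := hR.1 e he0
  rw [hRe] at hRe0
  filter_upwards [hRe0, ae_all_iff.2 hn, BanachFunctionSpace.coeFn_sub
    ((C : 𝕜) • R (indLp 𝕜 μ MeasurableSet.univ))
    (∑ n ∈ Finset.range N, (c n : 𝕜) • R (indLp 𝕜 μ (hs n))),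
    BanachFunctionSpace.coeFn_sum (Finset.range N) (fun n => (c n : 𝕜) • R (indLp 𝕜 μ (hs n))),
    ae_all_iff.2 fun n => BanachFunctionSpace.coeFn_smul (c n : 𝕜) (R (indLp 𝕜 μ (hs n)))]
    with b h1 h2 h3 h4 h5
  rw [h3, sub_nonneg, h4] at h1
  have h6 : ((∑ n ∈ Finset.range N, ‖(T (indLp 𝕜 μ (hs n)) : B →ₘ[ν] 𝕜) b‖ * c n : ℝ) : 𝕜) ≤
      (((C : 𝕜) • R (indLp 𝕜 μ MeasurableSet.univ) : G.carrier) : B →ₘ[ν] 𝕜) b := by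
    refine le_trans ?_ h1
    rw [RCLike.ofReal_sum]
    refine Finset.sum_le_sum fun n _ => ?_
    rw [h5, RCLike.ofReal_mul, mul_comm]
    exact mul_le_mul_of_nonneg_left (h2 n) (by simpa using hc n)
  have h7 := (RCLike.le_iff_re_im.1 h6).1
  rw [RCLike.ofReal_re] at h7
  exact h7.trans (RCLike.re_le_norm _)

/-- Boundedly convergent series of indicator functions are mapped to pointwise series. -/
theorem IsKoetheAdjoint.ae_eq_tsum {hFG : IsKoetheDualPair F G} {T : Lp 𝕜 ∞ μ →L[𝕜] G.carrier}
    {S : F.carrier →L[𝕜] Lp 𝕜 1 μ} (hS : IsKoetheAdjoint hFG T S)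
    {s : ℕ → Set A} (hs : ∀ n, MeasurableSet (s n)) {c : ℕ → 𝕜} {C : ℝ}
    (hC : ∀ a N, ‖∑ n ∈ Finset.range N, (s n).indicator (fun _ => c n) a‖ ≤ C)
    {k : Lp 𝕜 ∞ μ} (hk : ∀ᵐ a ∂μ, HasSum (fun n => (s n).indicator (fun _ => c n) a) (k a))
    {D γ : G.carrier}
    (hD : ∀ N, ∀ᵐ b ∂ν, ‖∑ n ∈ Finset.range N, (T (indLp 𝕜 μ (hs n)) : B →ₘ[ν] 𝕜) b * c n‖ ≤
      ‖(D : B →ₘ[ν] 𝕜) b‖)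
    (hγ : ∀ᵐ b ∂ν, HasSum (fun n => (T (indLp 𝕜 μ (hs n)) : B →ₘ[ν] 𝕜) b * c n)
      ((γ : B →ₘ[ν] 𝕜) b)) : T k = γ := by
  let kN : ℕ → Lp 𝕜 ∞ μ := fun N => ∑ n ∈ Finset.range N, c n • indLp 𝕜 μ (hs n)
  have hTk : ∀ N, ∀ᵐ b ∂ν, (T (kN N) : B →ₘ[ν] 𝕜) b =
      ∑ n ∈ Finset.range N, (T (indLp 𝕜 μ (hs n)) : B →ₘ[ν] 𝕜) b * c n := fun N => by
    have h1 : T (kN N) = ∑ n ∈ Finset.range N, c n • T (indLp 𝕜 μ (hs n)) := by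
      simp_rw [kN, map_sum, map_smul]
    rw [h1]
    filter_upwards [BanachFunctionSpace.coeFn_sum (Finset.range N)
      (fun n => c n • T (indLp 𝕜 μ (hs n))),
      ae_all_iff.2 fun n => BanachFunctionSpace.coeFn_smul (c n) (T (indLp 𝕜 μ (hs n)))]
      with b h1 h2
    rw [h1]
    exact Finset.sum_congr rfl fun n _ => by rw [h2, mul_comm]
  refine sub_eq_zero.1 (hFG.separating_right _ fun f => ?_)
  change hFG.pairing f (T k - γ) = 0
  rw [map_sub, sub_eq_zero]
  -- Dominated convergence over `B`, with majorant `|f D|`.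
  have lim1 : Tendsto (fun N => hFG.pairing f (T (kN N))) atTop (𝓝 (hFG.pairing f γ)) := by
    simp_rw [IsKoetheDualPair.pairing_apply]
    refine tendsto_integral_of_dominated_convergence
      (fun b => ‖(f : B →ₘ[ν] 𝕜) b * (D : B →ₘ[ν] 𝕜) b‖)
      (fun N => (hFG.integrable f (T (kN N))).aestronglyMeasurable) (hFG.integrable f D).norm
      (fun N => ?_) ?_
    · filter_upwards [hTk N, hD N] with b h1 h2
      rw [h1, norm_mul, norm_mul]
      exact mul_le_mul_of_nonneg_left h2 (norm_nonneg _)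
    · filter_upwards [ae_all_iff.2 hTk, hγ] with b h1 h2
      simp_rw [h1]
      exact h2.tendsto_sum_nat.const_mul _
  -- Dominated convergence over `A`, after moving `T` to the other side as `S f`, which is
  -- integrable.
  have lim2 : Tendsto (fun N => hFG.pairing f (T (kN N))) atTop (𝓝 (hFG.pairing f (T k))) := by
    simp_rw [← hS f, lOneLInftyPairing_apply]
    have hSf : Integrable (S f) μ := L1.integrable_coeFn (S f)
    refine tendsto_integral_of_dominated_convergence (fun a => ‖S f a‖ * C)
      (fun N => ?_) (hSf.norm.mul_const C) (fun N => ?_) ?_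
    · exact (Lp.aestronglyMeasurable (S f)).mul (Lp.aestronglyMeasurable (kN N))
    · filter_upwards [coeFn_sum_smul_indLp (μ := μ) hs c N] with a h1
      rw [ContinuousLinearMap.mul_apply', h1, norm_mul]
      exact mul_le_mul_of_nonneg_left (hC a N) (norm_nonneg _)
    · filter_upwards [ae_all_iff.2 fun N => coeFn_sum_smul_indLp (μ := μ) hs c N, hk] with a h1 h2
      simp_rw [ContinuousLinearMap.mul_apply', kN, h1]
      exact h2.tendsto_sum_nat.const_mul _
  exact tendsto_nhds_unique lim2 lim1

/-- `g` is the value at `h` of the `Y`-valued extension of `T`. -/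
def IsValuedImage (β : X →L[𝕜] Y →L[𝕜] 𝕜) (T : Lp 𝕜 ∞ μ →L[𝕜] G.carrier) (h : Lp Y ∞ μ)
    (g : G.Bochner Y) : Prop :=
  ∀ x, ∀ᵐ b ∂ν, β x ((g : B →ₘ[ν] Y) b) = (T ((β x).compLp h) : B →ₘ[ν] 𝕜) b

/-- The function `g` is `∑ T 1_{s n} y n` for a series `h = ∑ 1_{s n} y n`. It converges absolutely
because a multiple of `R 1` dominates the sum of the norms. -/
theorem IsKoetheAdjoint.exists_valuedImage [CompleteSpace Y] {hFG : IsKoetheDualPair F G}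
    {T : Lp 𝕜 ∞ μ →L[𝕜] G.carrier} {S : F.carrier →L[𝕜] Lp 𝕜 1 μ} (hS : IsKoetheAdjoint hFG T S)
    {R : Lp 𝕜 ∞ μ →L[𝕜] G.carrier} (hR : IsDominant T R) (β : X →L[𝕜] Y →L[𝕜] 𝕜) (h : Lp Y ∞ μ)
    {ε : ℝ} (hε : 0 < ε) :
    ∃ g : G.Bochner Y, IsValuedImage β T h g ∧ ‖g‖ ≤ (‖h‖ + ε) * ‖R‖ := by
  have hmeas : MeasurableSet {a | ‖h a‖ ≤ ‖h‖} :=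
    (Lp.stronglyMeasurable h).norm.measurableSet_le stronglyMeasurable_const
  -- The series requires a bound at every point, so `h` is set to zero on the null set where it
  -- exceeds its norm.
  obtain ⟨s, y, hs, hsy⟩ := exists_indicator_series (M := ‖h‖)
    ((Lp.stronglyMeasurable h).indicator hmeas) (fun a => by
      by_cases ha : a ∈ {a | ‖h a‖ ≤ ‖h‖}
      · rw [Set.indicator_of_mem ha]; exact ha
      · rw [Set.indicator_of_notMem ha]; simp) hε
  have hh : ∀ᵐ a ∂μ, HasSum (fun n => (s n).indicator (fun _ => y n) a) (h a) := by
    filter_upwards [ae_norm_le_norm_lInfty h] with a ha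
    have := (hsy a).1
    rwa [Set.indicator_of_mem (show a ∈ {a | ‖h a‖ ≤ ‖h‖} from ha)] at this
  set D : G.carrier := ((‖h‖ + ε : ℝ) : 𝕜) • R (indLp 𝕜 μ MeasurableSet.univ) with hDdef
  have hDn : ‖D‖ ≤ (‖h‖ + ε) * ‖R‖ := by
    rw [hDdef, norm_smul, RCLike.norm_ofReal, abs_of_nonneg (by positivity)]
    refine mul_le_mul_of_nonneg_left ?_ (by positivity)
    simpa using R.le_opNorm_of_le (norm_indLp_le (𝕜 := 𝕜) (μ := μ) MeasurableSet.univ)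
  have hD := hR.sum_norm_mul_le (ν := ν) hs (c := fun n => ‖y n‖) (fun n => norm_nonneg _)
    fun a => (hsy a).2
  have hsum : ∀ᵐ b ∂ν, Summable fun n => ‖(T (indLp 𝕜 μ (hs n)) : B →ₘ[ν] 𝕜) b • y n‖ := by
    filter_upwards [hD] with b hb
    refine summable_of_sum_range_le (c := ‖(D : B →ₘ[ν] 𝕜) b‖) (fun _ => norm_nonneg _) fun N => ?_
    simp_rw [norm_smul]
    exact hb N
  have hg0m : AEStronglyMeasurable
      (fun b => ∑' n, (T (indLp 𝕜 μ (hs n)) : B →ₘ[ν] 𝕜) b • y n) ν := by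
    refine aestronglyMeasurable_of_tendsto_ae atTop (f := fun N b =>
      ∑ n ∈ Finset.range N, (T (indLp 𝕜 μ (hs n)) : B →ₘ[ν] 𝕜) b • y n) (fun N => ?_) ?_
    · exact Finset.aestronglyMeasurable_fun_sum _ fun n _ =>
        (AEEqFun.aestronglyMeasurable _).smul_const _
    · filter_upwards [hsum] with b hb using hb.of_norm.hasSum.tendsto_sum_nat
  obtain ⟨g, hg, hgn⟩ := G.exists_bochner_ae_eq hg0m D (by
    filter_upwards [hsum, hD] with b h1 h2
    refine (norm_tsum_le_tsum_norm h1).trans (h1.tsum_le_of_sum_range_le fun N => ?_)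
    simp_rw [norm_smul]
    exact h2 N)
  refine ⟨g, fun x => ?_, hgn.trans hDn⟩
  obtain ⟨γ, hγ⟩ := BanachFunctionSpace.Bochner.exists_apply_ae_eq (β x) g
  -- Applying `β x` to both series gives scalar series over the same sets with coefficients `β x (y
  -- n)`.
  have key : T ((β x).compLp h) = γ := by
    refine hS.ae_eq_tsum hs (c := fun n => β x (y n)) (C := ‖β x‖ * (‖h‖ + ε))
      (D := ((‖β x‖ : ℝ) : 𝕜) • D) (fun a N => ?_) ?_ (fun N => ?_) ?_
    · have h1 : ∑ n ∈ Finset.range N, (s n).indicator (fun _ => β x (y n)) a =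
          β x (∑ n ∈ Finset.range N, (s n).indicator (fun _ => y n) a) := by
        rw [map_sum]
        refine Finset.sum_congr rfl fun n _ => ?_
        by_cases hn : a ∈ s n <;> simp [hn]
      rw [h1]
      refine (β x).le_opNorm_of_le ((norm_sum_le _ _).trans (le_trans (le_of_eq ?_) ((hsy a).2 N)))
      refine Finset.sum_congr rfl fun n _ => ?_
      by_cases hn : a ∈ s n <;> simp [hn]
    · filter_upwards [hh, (β x).coeFn_compLp h] with a h1 h2
      rw [h2]
      convert (β x).hasSum h1 using 2 with n
      by_cases hn : a ∈ s n <;> simp [hn]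
    · filter_upwards [hD, BanachFunctionSpace.coeFn_smul ((‖β x‖ : ℝ) : 𝕜) D] with b h1 h2
      rw [h2, norm_mul, RCLike.norm_ofReal, abs_norm]
      refine (norm_sum_le _ _).trans
        (le_trans ?_ (mul_le_mul_of_nonneg_left (h1 N) (norm_nonneg _)))
      rw [Finset.mul_sum]
      refine Finset.sum_le_sum fun n _ => ?_
      rw [norm_mul, mul_left_comm]
      exact mul_le_mul_of_nonneg_left ((β x).le_opNorm _) (norm_nonneg _)
    · filter_upwards [hγ, hg, hsum] with b h1 h2 h3
      rw [h1, h2]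
      convert (β x).hasSum h3.of_norm.hasSum using 2 with n
      simp
  rw [key]
  exact hγ.mono fun b hb => hb.symm

theorem IsValuedImage.unique {β : X →L[𝕜] Y →L[𝕜] 𝕜} (hβ : Function.Injective β.flip)
    {T : Lp 𝕜 ∞ μ →L[𝕜] G.carrier} {h : Lp Y ∞ μ} {g g' : G.Bochner Y}
    (hg : IsValuedImage β T h g) (hg' : IsValuedImage β T h g') : g = g' :=
  BanachFunctionSpace.Bochner.ext_apply hβ fun x => by
    filter_upwards [hg x, hg' x] with b h1 h2
    rw [h1, h2]

theorem IsValuedImage.add {β : X →L[𝕜] Y →L[𝕜] 𝕜} {T : Lp 𝕜 ∞ μ →L[𝕜] G.carrier}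
    {h h' : Lp Y ∞ μ} {g g' : G.Bochner Y} (hg : IsValuedImage β T h g)
    (hg' : IsValuedImage β T h' g') : IsValuedImage β T (h + h') (g + g') := fun x => by
  have h0 : (β x).compLp (h + h') = (β x).compLp h + (β x).compLp h' :=
    map_add ((β x).compLpₗ ∞ μ) h h'
  rw [h0, map_add]
  filter_upwards [hg x, hg' x, BanachFunctionSpace.Bochner.coeFn_add g g',
    BanachFunctionSpace.coeFn_add (T ((β x).compLp h)) (T ((β x).compLp h'))] with b h1 h2 h3 h4
  rw [h3, h4, map_add, h1, h2]

theorem IsValuedImage.smul {β : X →L[𝕜] Y →L[𝕜] 𝕜} {T : Lp 𝕜 ∞ μ →L[𝕜] G.carrier}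
    {h : Lp Y ∞ μ} {g : G.Bochner Y} (hg : IsValuedImage β T h g) (c : 𝕜) :
    IsValuedImage β T (c • h) (c • g) := fun x => by
  have h0 : (β x).compLp (c • h) = c • (β x).compLp h :=
    map_smul ((β x).compLpₗ ∞ μ) c h
  rw [h0, map_smul]
  filter_upwards [hg x, BanachFunctionSpace.Bochner.coeFn_smul c g,
    BanachFunctionSpace.coeFn_smul c (T ((β x).compLp h))] with b h1 h2 h3
  rw [h2, h3, map_smul, h1, smul_eq_mul]

theorem isValuedImage_tensor (β : X →L[𝕜] Y →L[𝕜] 𝕜) (T : Lp 𝕜 ∞ μ →L[𝕜] G.carrier)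
    (h : Lp 𝕜 ∞ μ) (y : Y) :
    IsValuedImage β T ((ContinuousLinearMap.toSpanSingleton 𝕜 y).compLp h)
      (BanachFunctionSpace.Bochner.tensor (T h) y) := fun x => by
  have h0 : (β x).compLp ((ContinuousLinearMap.toSpanSingleton 𝕜 y).compLp h) = β x y • h := by
    refine Lp.ext ?_
    filter_upwards [(β x).coeFn_compLp ((ContinuousLinearMap.toSpanSingleton 𝕜 y).compLp h),
      (ContinuousLinearMap.toSpanSingleton 𝕜 y).coeFn_compLp h, Lp.coeFn_smul (β x y) h]
      with a h1 h2 h3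
    rw [h1, h2, h3]
    simp [mul_comm]
  rw [h0, map_smul]
  filter_upwards [BanachFunctionSpace.Bochner.coeFn_tensor (T h) y,
    BanachFunctionSpace.coeFn_smul (β x y) (T h)] with b h1 h2
  rw [h1, h2]
  simp [mul_comm]

/-- Existence of the `Y`-valued extension of a dominated operator that has an adjoint. -/
theorem IsKoetheAdjoint.exists_valuedExtension [CompleteSpace Y] {hFG : IsKoetheDualPair F G}
    {T : Lp 𝕜 ∞ μ →L[𝕜] G.carrier} {S : F.carrier →L[𝕜] Lp 𝕜 1 μ} (hS : IsKoetheAdjoint hFG T S)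
    (hT : IsDominated T) {β : X →L[𝕜] Y →L[𝕜] 𝕜} (hβ : Function.Injective β.flip) :
    ∃ TY : Lp Y ∞ μ →L[𝕜] G.Bochner Y, (∀ h, IsValuedImage β T h (TY h)) ∧
      ‖TY‖ ≤ dominatedNorm T := by
  obtain ⟨R₀, hR₀⟩ := hT
  choose t ht htn using fun h : Lp Y ∞ μ => hS.exists_valuedImage hR₀ β h zero_lt_one
  -- The choice `t` was made with one dominant and `ε = 1`, but by uniqueness it is also the
  -- function produced by any other dominant and any `ε`; then `ε` tends to `0`.
  have hbound : ∀ R, IsDominant T R → ∀ h, ‖t h‖ ≤ ‖R‖ * ‖h‖ := fun R hR h => by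
    have h1 : ∀ ε > 0, ‖t h‖ ≤ (‖h‖ + ε) * ‖R‖ := fun ε hε => by
      obtain ⟨g, hg, hgn⟩ := hS.exists_valuedImage hR β h hε
      rwa [(ht h).unique hβ hg]
    have h2 : Tendsto (fun ε : ℝ => (‖h‖ + ε) * ‖R‖) (𝓝[>] 0) (𝓝 ((‖h‖ + 0) * ‖R‖)) :=
      (Continuous.tendsto (by fun_prop) 0).mono_left nhdsWithin_le_nhds
    have h3 := ge_of_tendsto h2 (eventually_mem_nhdsWithin.mono h1)
    rw [add_zero, mul_comm] at h3
    exact h3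
  let L : Lp Y ∞ μ →ₗ[𝕜] G.Bochner Y :=
    { toFun := t
      map_add' := fun h h' => (ht (h + h')).unique hβ ((ht h).add (ht h'))
      map_smul' := fun c h => (ht (c • h)).unique hβ ((ht h).smul c) }
  refine ⟨L.mkContinuous ‖R₀‖ (hbound R₀ hR₀), ht, ?_⟩
  refine le_csInf ⟨_, R₀, hR₀, rfl⟩ ?_
  rintro _ ⟨R, hR, rfl⟩
  exact ContinuousLinearMap.opNorm_le_bound _ (norm_nonneg _) (hbound R hR)

end ValuedExtension

/-! ### The extension of `S ⊗ I_X` and its duality with `T_Y`. -/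

section DominantFunctionSpace

variable {𝕜 : Type*} [RCLike 𝕜] {A : Type*} [MeasurableSpace A] {μ : Measure A}
  {B : Type*} [MeasurableSpace B] {ν : Measure B} {F G : BanachFunctionSpace 𝕜 ν}
  {X Y : Type*} [NormedAddCommGroup X] [NormedSpace 𝕜 X] [NormedAddCommGroup Y] [NormedSpace 𝕜 Y]

theorem BanachFunctionSpace.exists_modulus (f : F.carrier) :
    ∃ g : F.carrier, (∀ᵐ b ∂ν, (g : B →ₘ[ν] 𝕜) b = ((‖(f : B →ₘ[ν] 𝕜) b‖ : ℝ) : 𝕜)) ∧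
      ‖g‖ ≤ ‖f‖ :=
  F.exists_ae_eq (f := fun b => ((‖(f : B →ₘ[ν] 𝕜) b‖ : ℝ) : 𝕜))
    (RCLike.continuous_ofReal.comp_aestronglyMeasurable
      (AEEqFun.aestronglyMeasurable (f : B →ₘ[ν] 𝕜)).norm) f (ae_of_all _ fun b => by simp)

theorem IsPositiveOp.ae_le {R : F.carrier →L[𝕜] Lp 𝕜 1 μ} (hR : IsPositiveOp R) {e g : F.carrier}
    (h : ∀ᵐ b ∂ν, (e : B →ₘ[ν] 𝕜) b ≤ (g : B →ₘ[ν] 𝕜) b) :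
    ∀ᵐ a ∂μ, R e a ≤ R g a := by
  have h1 := hR (g - e) (by
    filter_upwards [h, BanachFunctionSpace.coeFn_sub g e] with b h1 h2
    rw [h2]
    exact sub_nonneg.2 h1)
  rw [map_sub] at h1
  filter_upwards [h1, Lp.coeFn_sub (R g) (R e)] with a h2 h3
  rw [h3] at h2
  exact sub_nonneg.1 h2

theorem IsDominant.ae_le {S R : F.carrier →L[𝕜] Lp 𝕜 1 μ} (hR : IsDominant S R) {e g : F.carrier}
    (h : ∀ᵐ b ∂ν, ((‖(e : B →ₘ[ν] 𝕜) b‖ : ℝ) : 𝕜) ≤ (g : B →ₘ[ν] 𝕜) b) :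
    ∀ᵐ a ∂μ, ((‖S e a‖ : ℝ) : 𝕜) ≤ R g a := by
  obtain ⟨m, hm, -⟩ := BanachFunctionSpace.exists_modulus e
  filter_upwards [hR.2 e m hm, hR.1.ae_le (e := m) (g := g) (by
    filter_upwards [h, hm] with b h1 h2
    rwa [h2])] with a h1 h2
  exact h1.trans h2

theorem norm_le_norm_of_ofReal_norm_le {X : Type*} [NormedAddCommGroup X] {x : X} {z : 𝕜}
    (h : ((‖x‖ : ℝ) : 𝕜) ≤ z) : ‖x‖ ≤ ‖z‖ := by
  have h7 := (RCLike.le_iff_re_im.1 h).1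
  rw [RCLike.ofReal_re] at h7
  exact h7.trans (RCLike.re_le_norm _)

theorem BanachFunctionSpace.Bochner.coeFn_sum_tensor {ι : Type*} (s : Finset ι) (f : ι → F.carrier)
    (x : ι → X) : ∀ᵐ b ∂ν, ((∑ i ∈ s, tensor (f i) (x i) : F.Bochner X) : B →ₘ[ν] X) b =
      ∑ i ∈ s, (f i : B →ₘ[ν] 𝕜) b • x i := by
  classical
  induction s using Finset.induction_on with
  | empty =>
    simp only [Finset.sum_empty]
    exact AEEqFun.coeFn_zero (μ := ν) (β := X)
  | insert i s hi ih =>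
    filter_upwards [ih, coeFn_add (tensor (f i) (x i)) (∑ j ∈ s, tensor (f j) (x j)),
      coeFn_tensor (f i) (x i)] with b h1 h2 h3
    rw [Finset.sum_insert hi, Finset.sum_insert hi, h2, h1, h3]

/-- The pointwise domination of `∑ S f i ⊗ x i` by `R ‖∑ f i ⊗ x i‖`. -/
theorem IsDominant.ae_norm_sum_smul_le {S R : F.carrier →L[𝕜] Lp 𝕜 1 μ} (hR : IsDominant S R)
    {ι : Type*} (s : Finset ι) (f : ι → F.carrier) (x : ι → X) :
    ∀ᵐ a ∂μ, ‖∑ i ∈ s, S (f i) a • x i‖ ≤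
      ‖R (∑ i ∈ s, BanachFunctionSpace.Bochner.tensor (f i) (x i)).normElt a‖ := by
  classical
  have hsep : TopologicalSpace.IsSeparable
      (Submodule.span 𝕜 ((s.image x : Finset X) : Set X) : Set X) :=
    (Finset.finite_toSet _).isSeparable.span
  -- All values lie in the span of the finitely many `x i`; countably many norming functionals keep
  -- the exceptional set null.
  obtain ⟨φ, hφ, hnorm⟩ := exists_seq_norming 𝕜 hsep
  have h1 : ∀ n, ∀ᵐ a ∂μ, ‖φ n (∑ i ∈ s, S (f i) a • x i)‖ ≤
      ‖R (∑ i ∈ s, BanachFunctionSpace.Bochner.tensor (f i) (x i)).normElt a‖ := fun n => by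
    -- Domination is applied to the scalar function `φ n (∑ f i ⊗ x i)`, whose modulus is at most
    -- `‖∑ f i ⊗ x i‖` since `‖φ n‖ ≤ 1`.
    have h2 := hR.ae_le (e := ∑ i ∈ s, φ n (x i) • f i)
      (g := (∑ i ∈ s, BanachFunctionSpace.Bochner.tensor (f i) (x i)).normElt) (by
      filter_upwards [BanachFunctionSpace.Bochner.coeFn_normElt
        (∑ i ∈ s, BanachFunctionSpace.Bochner.tensor (f i) (x i)),
        BanachFunctionSpace.Bochner.coeFn_sum_tensor s f x,
        BanachFunctionSpace.coeFn_sum s fun i => φ n (x i) • f i,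
        (Finset.eventually_all s).2 fun i _ => BanachFunctionSpace.coeFn_smul (φ n (x i)) (f i)]
        with b h3 h4 h5 h6
      rw [h3, h4, h5]
      refine RCLike.ofReal_le_ofReal.2 ?_
      have h7 : ∑ i ∈ s, ((φ n (x i) • f i : F.carrier) : B →ₘ[ν] 𝕜) b =
          φ n (∑ i ∈ s, (f i : B →ₘ[ν] 𝕜) b • x i) := by
        rw [map_sum]
        refine Finset.sum_congr rfl fun i hi => ?_
        rw [h6 i hi, map_smul, smul_eq_mul, mul_comm]
      rw [h7]
      simpa using (φ n).le_of_opNorm_le (hφ n) (∑ i ∈ s, (f i : B →ₘ[ν] 𝕜) b • x i))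
    have h3 : S (∑ i ∈ s, φ n (x i) • f i) = ∑ i ∈ s, φ n (x i) • S (f i) := by
      simp_rw [map_sum, map_smul]
    rw [h3] at h2
    filter_upwards [h2, Lp.coeFn_finsetSum s fun i => φ n (x i) • S (f i),
      (Finset.eventually_all s).2 fun i _ => Lp.coeFn_smul (φ n (x i)) (S (f i))] with a h4 h5 h6
    refine le_trans (le_of_eq ?_) (norm_le_norm_of_ofReal_norm_le h4)
    rw [h5, Finset.sum_apply, map_sum]
    congr 1
    refine Finset.sum_congr rfl fun i hi => ?_
    rw [h6 i hi, map_smul, Pi.smul_apply, smul_eq_mul, smul_eq_mul, mul_comm]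
  filter_upwards [ae_all_iff.2 h1] with a ha
  refine hnorm _ (Submodule.sum_mem _ fun i hi => Submodule.smul_mem _ _ (Submodule.subset_span ?_))
    _ ha
  exact Finset.mem_coe.2 (Finset.mem_image_of_mem x hi)

/-- The canonical map of the algebraic tensor product to `F ⊗̃ X`. -/
noncomputable def tensorToClosure (F : BanachFunctionSpace 𝕜 ν) (X : Type*) [NormedAddCommGroup X]
    [NormedSpace 𝕜 X] : TensorProduct 𝕜 F.carrier X →ₗ[𝕜] F.tensorClosure X :=
  TensorProduct.lift (LinearMap.mk₂ 𝕜 BanachFunctionSpace.tensorMk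
    (fun f f' x => Subtype.ext (BanachFunctionSpace.Bochner.ext_ae (by
      filter_upwards [BanachFunctionSpace.Bochner.coeFn_tensor (f + f') x,
        BanachFunctionSpace.Bochner.coeFn_tensor f x, BanachFunctionSpace.Bochner.coeFn_tensor f' x,
        BanachFunctionSpace.Bochner.coeFn_add (BanachFunctionSpace.Bochner.tensor f x)
          (BanachFunctionSpace.Bochner.tensor f' x), BanachFunctionSpace.coeFn_add f f']
        with b h1 h2 h3 h4 h5
      exact h1.trans (by rw [h5, add_smul, ← h2, ← h3]; exact h4.symm))))
    (fun c f x => Subtype.ext (BanachFunctionSpace.Bochner.ext_ae (by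
      filter_upwards [BanachFunctionSpace.Bochner.coeFn_tensor (c • f) x,
        BanachFunctionSpace.Bochner.coeFn_tensor f x,
        BanachFunctionSpace.Bochner.coeFn_smul c (BanachFunctionSpace.Bochner.tensor f x),
        BanachFunctionSpace.coeFn_smul c f]
        with b h1 h2 h3 h4
      exact h1.trans (by rw [h4, mul_smul, ← h2]; exact h3.symm))))
    (fun f x x' => Subtype.ext (BanachFunctionSpace.Bochner.ext_ae (by
      filter_upwards [BanachFunctionSpace.Bochner.coeFn_tensor f (x + x'),
        BanachFunctionSpace.Bochner.coeFn_tensor f x, BanachFunctionSpace.Bochner.coeFn_tensor f x',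
        BanachFunctionSpace.Bochner.coeFn_add (BanachFunctionSpace.Bochner.tensor f x)
          (BanachFunctionSpace.Bochner.tensor f x')]
        with b h1 h2 h3 h4
      exact h1.trans (by rw [smul_add, ← h2, ← h3]; exact h4.symm))))
    (fun c f x => Subtype.ext (BanachFunctionSpace.Bochner.ext_ae (by
      filter_upwards [BanachFunctionSpace.Bochner.coeFn_tensor f (c • x),
        BanachFunctionSpace.Bochner.coeFn_tensor f x,
        BanachFunctionSpace.Bochner.coeFn_smul c (BanachFunctionSpace.Bochner.tensor f x)]
        with b h1 h2 h3
      exact h1.trans (by rw [smul_comm, ← h2]; exact h3.symm)))))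

theorem tensorToClosure_tmul (f : F.carrier) (x : X) :
    tensorToClosure F X (TensorProduct.tmul 𝕜 f x) = BanachFunctionSpace.tensorMk f x :=
  rfl

theorem denseRange_tensorToClosure : DenseRange (tensorToClosure F X) := by
  intro φ
  rw [closure_subtype]
  refine closure_mono ?_ φ.2
  have : Submodule.span 𝕜 {φ | ∃ (f : F.carrier) (x : X),
      φ = BanachFunctionSpace.Bochner.tensor f x} ≤
      (LinearMap.range (tensorToClosure F X)).map (F.tensorClosure X).subtype := by
    rw [Submodule.span_le]
    rintro _ ⟨f, x, rfl⟩
    exact ⟨_, ⟨TensorProduct.tmul 𝕜 f x, rfl⟩, rfl⟩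
  exact this

/-- The operator `S ⊗ I_X` on the algebraic tensor product. -/
noncomputable def tensorLOne (S : F.carrier →L[𝕜] Lp 𝕜 1 μ) (X : Type*) [NormedAddCommGroup X]
    [NormedSpace 𝕜 X] : TensorProduct 𝕜 F.carrier X →ₗ[𝕜] Lp X 1 μ :=
  TensorProduct.lift (LinearMap.mk₂ 𝕜
    (fun f x => (ContinuousLinearMap.toSpanSingleton 𝕜 x).compLp (S f))
    (fun f f' x => by
      rw [map_add]; exact map_add ((ContinuousLinearMap.toSpanSingleton 𝕜 x).compLpₗ 1 μ) _ _)
    (fun c f x => by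
      rw [map_smul]; exact map_smul ((ContinuousLinearMap.toSpanSingleton 𝕜 x).compLpₗ 1 μ) _ _)
    (fun f x x' => by
      rw [ContinuousLinearMap.toSpanSingleton_add, ContinuousLinearMap.add_compLp])
    (fun c f x => by
      rw [ContinuousLinearMap.toSpanSingleton_smul, ContinuousLinearMap.smul_compLp]))

theorem tensorLOne_tmul (S : F.carrier →L[𝕜] Lp 𝕜 1 μ) (f : F.carrier) (x : X) :
    tensorLOne S X (TensorProduct.tmul 𝕜 f x) =
      (ContinuousLinearMap.toSpanSingleton 𝕜 x).compLp (S f) :=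
  rfl

/-- The bound is by the norm of the image in `F ⊗̃ X`, so it also shows that `S ⊗ I_X` depends only
on that image and extends by density. -/
theorem IsDominant.norm_tensorLOne_le {S R : F.carrier →L[𝕜] Lp 𝕜 1 μ} (hR : IsDominant S R)
    (t : TensorProduct 𝕜 F.carrier X) : ‖tensorLOne S X t‖ ≤ ‖R‖ * ‖tensorToClosure F X t‖ := by
  obtain ⟨s, rfl⟩ := TensorProduct.exists_finset t
  have h1 : ((tensorToClosure F X (∑ i ∈ s, TensorProduct.tmul 𝕜 i.1 i.2) : F.tensorClosure X) :
      F.Bochner X) = ∑ i ∈ s, BanachFunctionSpace.Bochner.tensor i.1 i.2 := by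
    rw [map_sum, AddSubmonoidClass.coe_finsetSum]
    rfl
  change _ ≤ ‖R‖ * ‖((tensorToClosure F X (∑ i ∈ s, TensorProduct.tmul 𝕜 i.1 i.2) :
    F.tensorClosure X) : F.Bochner X)‖
  rw [h1, map_sum]
  simp_rw [tensorLOne_tmul]
  refine le_trans (Lp.norm_le_norm_of_ae_le ?_) (R.le_opNorm
    (∑ i ∈ s, BanachFunctionSpace.Bochner.tensor i.1 i.2).normElt)
  filter_upwards [hR.ae_norm_sum_smul_le s Prod.fst Prod.snd, Lp.coeFn_finsetSum s fun i =>
    (ContinuousLinearMap.toSpanSingleton 𝕜 i.2).compLp (S i.1), (Finset.eventually_all s).2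
    fun i _ => (ContinuousLinearMap.toSpanSingleton 𝕜 i.2).coeFn_compLp (S i.1)] with a h2 h3 h4
  rw [h3, Finset.sum_apply]
  refine le_trans (le_of_eq (congrArg _ (Finset.sum_congr rfl fun i hi => ?_))) h2
  rw [h4 i hi, ContinuousLinearMap.toSpanSingleton_apply]

theorem tensorClosure_ext {Z : Type*} [NormedAddCommGroup Z] [NormedSpace 𝕜 Z]
    {U V : F.tensorClosure X →L[𝕜] Z}
    (h : ∀ (f : F.carrier) (x : X), U (BanachFunctionSpace.tensorMk f x) =
      V (BanachFunctionSpace.tensorMk f x)) : U = V := by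
  have h1 : U.toLinearMap.comp (tensorToClosure F X) = V.toLinearMap.comp (tensorToClosure F X) :=
    TensorProduct.ext' h
  refine DFunLike.coe_injective (denseRange_tensorToClosure.equalizer U.continuous V.continuous ?_)
  exact congrArg DFunLike.coe h1

/-- The bounded extension of `S ⊗ I_X` to `F ⊗̃ X` for a dominated operator `S`. -/
theorem exists_tensorExtension [CompleteSpace X] {S : F.carrier →L[𝕜] Lp 𝕜 1 μ}
    (hS : IsDominated S) : ∃ SX : F.tensorClosure X →L[𝕜] Lp X 1 μ,
      (∀ (f : F.carrier) (x : X), SX (BanachFunctionSpace.tensorMk f x) =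
        (ContinuousLinearMap.toSpanSingleton 𝕜 x).compLp (S f)) ∧ ‖SX‖ ≤ dominatedNorm S := by
  obtain ⟨R₀, hR₀⟩ := hS
  refine ⟨(tensorLOne S X).extendOfNorm (tensorToClosure F X), fun f x => ?_, ?_⟩
  · rw [← tensorToClosure_tmul, ← tensorLOne_tmul]
    exact LinearMap.extendOfNorm_eq (by exact denseRange_tensorToClosure)
      (by exact ⟨_, hR₀.norm_tensorLOne_le⟩) _
  -- The extension does not involve the dominant, so every dominant bounds it.
  · refine le_csInf ⟨_, R₀, hR₀, rfl⟩ ?_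
    rintro _ ⟨R, hR, rfl⟩
    exact ContinuousLinearMap.opNorm_le_bound _ (norm_nonneg R)
      (LinearMap.norm_extendOfNorm_apply_le (by exact denseRange_tensorToClosure) ‖R‖
        (by exact hR.norm_tensorLOne_le))

/-- The integral of `‖φ‖ ‖g‖` is itself a scalar pairing, of the elements `‖φ‖` of `F` and `‖g‖` of
`G`. -/
theorem IsKoetheDualPair.exists_norm_bochnerPairing_le (hFG : IsKoetheDualPair F G)
    (β : X →L[𝕜] Y →L[𝕜] 𝕜) : ∃ C : ℝ, ∀ φ g, ‖hFG.bochnerPairing β φ g‖ ≤ C * ‖φ‖ * ‖g‖ := by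
  obtain ⟨C, hC⟩ := hFG.bounded
  refine ⟨‖β‖ * C, fun φ g => ?_⟩
  have h1 : ‖hFG.bochnerPairing β φ g‖ ≤ ‖β‖ * ‖hFG.pairing φ.normElt g.normElt‖ := by
    have h2 : hFG.pairing φ.normElt g.normElt =
        ((∫ b, ‖(φ : B →ₘ[ν] X) b‖ * ‖(g : B →ₘ[ν] Y) b‖ ∂ν : ℝ) : 𝕜) := by
      rw [← integral_ofReal, IsKoetheDualPair.pairing_apply]
      refine integral_congr_ae ?_
      filter_upwards [φ.coeFn_normElt, g.coeFn_normElt] with b h1 h2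
      rw [h1, h2, RCLike.ofReal_mul]
    have h3 : Integrable (fun b => ‖(φ : B →ₘ[ν] X) b‖ * ‖(g : B →ₘ[ν] Y) b‖) ν := by
      refine (hFG.integrable φ.normElt g.normElt).norm.congr ?_
      filter_upwards [φ.coeFn_normElt, g.coeFn_normElt] with b h1 h2
      rw [h1, h2]
      simp
    rw [h2, RCLike.norm_ofReal, abs_of_nonneg (integral_nonneg fun b => by positivity),
      ← integral_const_mul, IsKoetheDualPair.bochnerPairing_apply]
    refine norm_integral_le_of_norm_le (h3.const_mul _) (ae_of_all _ fun b => ?_)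
    rw [← mul_assoc]
    exact β.le_opNorm₂ _ _
  refine h1.trans ?_
  calc ‖β‖ * ‖hFG.pairing φ.normElt g.normElt‖ ≤ ‖β‖ * (C * ‖φ.normElt‖ * ‖g.normElt‖) :=
        mul_le_mul_of_nonneg_left (hC _ _) (norm_nonneg β)
    _ = ‖β‖ * C * ‖φ‖ * ‖g‖ := by
        rw [BanachFunctionSpace.Bochner.norm_def, BanachFunctionSpace.Bochner.norm_def]; ring

theorem IsKoetheDualPair.bochnerPairing_tensor (hFG : IsKoetheDualPair F G)
    (β : X →L[𝕜] Y →L[𝕜] 𝕜) {f : F.carrier} {x : X} {g : G.Bochner Y} {γ : G.carrier}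
    (hγ : ∀ᵐ b ∂ν, β x ((g : B →ₘ[ν] Y) b) = (γ : B →ₘ[ν] 𝕜) b) :
    hFG.bochnerPairing β (BanachFunctionSpace.Bochner.tensor f x) g = hFG.pairing f γ := by
  rw [IsKoetheDualPair.bochnerPairing_apply, IsKoetheDualPair.pairing_apply]
  refine integral_congr_ae ?_
  filter_upwards [hγ, BanachFunctionSpace.Bochner.coeFn_tensor f x] with b h1 h2
  rw [h2, map_smul, smul_apply, h1, smul_eq_mul]

/-- The bounded extension of `S ⊗ I_X` is the adjoint of the `Y`-valued extension of `T`. -/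
theorem IsKoetheAdjoint.tensorPairing_eq {hFG : IsKoetheDualPair F G}
    {T : Lp 𝕜 ∞ μ →L[𝕜] G.carrier} {S : F.carrier →L[𝕜] Lp 𝕜 1 μ} (hS : IsKoetheAdjoint hFG T S)
    {β : X →L[𝕜] Y →L[𝕜] 𝕜} {SX : F.tensorClosure X →L[𝕜] Lp X 1 μ}
    (hSX : ∀ (f : F.carrier) (x : X), SX (BanachFunctionSpace.tensorMk f x) =
      (ContinuousLinearMap.toSpanSingleton 𝕜 x).compLp (S f))
    {h : Lp Y ∞ μ} {g : G.Bochner Y} (hg : IsValuedImage β T h g) (φ : F.tensorClosure X) :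
    lOneLInftyPairing μ β (SX φ) h = hFG.tensorPairing β φ g := by
  obtain ⟨C, hC⟩ := hFG.exists_norm_bochnerPairing_le β
  let V : F.tensorClosure X →L[𝕜] 𝕜 :=
    ((hFG.tensorPairing β).flip g).mkContinuous (C * ‖g‖) fun φ =>
      (hC φ g).trans (le_of_eq (by rw [Submodule.coe_norm]; ring))
  let U : F.tensorClosure X →L[𝕜] 𝕜 := ((β.lpPairing μ 1 ∞).flip h).comp SX
  -- Both sides are bounded functionals of `φ`, so elementary tensors suffice, and there the
  -- identity is the adjoint relation for `S`.
  have hUV : U = V := tensorClosure_ext fun f x => by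
    have h1 : U (BanachFunctionSpace.tensorMk f x) =
      lOneLInftyPairing μ β (SX (BanachFunctionSpace.tensorMk f x)) h := rfl
    rw [h1, hSX, lOneLInftyPairing_smul_left, hS]
    exact (hFG.bochnerPairing_tensor β (hg x)).symm
  exact DFunLike.congr_fun hUV φ

/-- Weak-to-weak continuous extensions of `T ⊗ I_Y` are `Y`-valued extensions of `T`. -/
theorem IsKoetheAdjoint.isValuedImage_of_weakWeakContinuous {hFG : IsKoetheDualPair F G}
    {T : Lp 𝕜 ∞ μ →L[𝕜] G.carrier} {S : F.carrier →L[𝕜] Lp 𝕜 1 μ} (hS : IsKoetheAdjoint hFG T S)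
    {β : X →L[𝕜] Y →L[𝕜] 𝕜} (hβ : Function.Injective β) {U : Lp Y ∞ μ →ₗ[𝕜] G.Bochner Y}
    (hU : ∀ (h : Lp 𝕜 ∞ μ) (y : Y), U ((ContinuousLinearMap.toSpanSingleton 𝕜 y).compLp h) =
      BanachFunctionSpace.Bochner.tensor (T h) y)
    (hUw : WeakWeakContinuous (lOneLInftyPairing μ β).flip (hFG.tensorPairing β).flip U)
    (h : Lp Y ∞ μ) : IsValuedImage β T h (U h) := by
  intro x
  obtain ⟨γ, hγ⟩ := BanachFunctionSpace.Bochner.exists_apply_ae_eq (β x) (U h)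
  have key : γ = T ((β x).compLp h) := by
    refine sub_eq_zero.1 (hFG.separating_right _ fun f => ?_)
    change hFG.pairing f (γ - T ((β x).compLp h)) = 0
    obtain ⟨u, hu⟩ := hUw.exists_adjoint (BanachFunctionSpace.tensorMk f x)
    replace hu : ∀ v, hFG.bochnerPairing β (BanachFunctionSpace.Bochner.tensor f x) (U v) =
      lOneLInftyPairing μ β u v := hu
    -- Pairing with the elementary tensors `k ⊗ y`, where `U` is prescribed, already determines the
    -- representing function `u`.
    have hu' : u = (ContinuousLinearMap.toSpanSingleton 𝕜 x).compLp (S f) := by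
      refine sub_eq_zero.1 (lOne_eq_zero_of_pairing_smul hβ fun k y => ?_)
      rw [map_sub, LinearMap.sub_apply, ← hu, hU, lOneLInftyPairing_smul_left, hS, sub_eq_zero]
      exact hFG.bochnerPairing_tensor β (isValuedImage_tensor β T k y x)
    rw [map_sub, sub_eq_zero, ← hS, ← lOneLInftyPairing_smul_left, ← hu', ← hu]
    exact (hFG.bochnerPairing_tensor β (hγ.mono fun b hb => hb.symm)).symm
  rw [← key]
  exact hγ.mono fun b hb => hb.symm

end DominantFunctionSpace

/-! ### Extension of additive maps from the positive cone. -/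

/-- A continuous additive map is real-linear; the real structures are obtained by restricting
scalars. -/
theorem Continuous.map_ofReal_smul {𝕜 : Type*} [RCLike 𝕜] {V Z : Type*} [NormedAddCommGroup V]
    [NormedSpace 𝕜 V] [NormedAddCommGroup Z] [NormedSpace 𝕜 Z] {P : V →+ Z} (hP : Continuous P)
    (c : ℝ) (f : V) : P ((c : 𝕜) • f) = (c : 𝕜) • P f := by
  let _ : NormedSpace ℝ V := NormedSpace.restrictScalars ℝ 𝕜 V
  let _ : NormedSpace ℝ Z := NormedSpace.restrictScalars ℝ 𝕜 Z
  exact map_real_smul P hP c f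

section Cone

variable {𝕜 : Type*} [RCLike 𝕜] {B : Type*} [MeasurableSpace B] {ν : Measure B}
  {F : BanachFunctionSpace 𝕜 ν}

namespace BanachFunctionSpace

/-- The function `f` is nonnegative almost everywhere. -/
def IsNonneg (f : F.carrier) : Prop := ∀ᵐ b ∂ν, 0 ≤ (f : B →ₘ[ν] 𝕜) b

theorem IsNonneg.add {f g : F.carrier} (hf : IsNonneg f) (hg : IsNonneg g) : IsNonneg (f + g) := by
  filter_upwards [hf, hg, coeFn_add f g] with b h1 h2 h3
  rw [h3]
  exact add_nonneg h1 h2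

theorem exists_realPosPart (f : F.carrier) : ∃ g : F.carrier,
    (∀ᵐ b ∂ν, (g : B →ₘ[ν] 𝕜) b = ((max (RCLike.re ((f : B →ₘ[ν] 𝕜) b)) 0 : ℝ) : 𝕜)) ∧
      ‖g‖ ≤ ‖f‖ := by
  refine F.exists_ae_eq (f := fun b => ((max (RCLike.re ((f : B →ₘ[ν] 𝕜) b)) 0 : ℝ) : 𝕜))
    ?_ f (ae_of_all _ fun b => ?_)
  · have hc : Continuous fun z : 𝕜 => ((max (RCLike.re z) 0 : ℝ) : 𝕜) :=
      RCLike.continuous_ofReal.comp (RCLike.continuous_re.max continuous_const)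
    exact hc.comp_aestronglyMeasurable (AEEqFun.aestronglyMeasurable (f : B →ₘ[ν] 𝕜))
  · rw [RCLike.norm_ofReal, abs_of_nonneg (le_max_right _ _)]
    exact max_le (RCLike.re_le_norm _) (norm_nonneg _)

/-- The positive part of the real part of `f`. -/
noncomputable def realPosPart (f : F.carrier) : F.carrier := (exists_realPosPart f).choose

theorem coeFn_realPosPart (f : F.carrier) : ∀ᵐ b ∂ν, (realPosPart f : B →ₘ[ν] 𝕜) b =
    ((max (RCLike.re ((f : B →ₘ[ν] 𝕜) b)) 0 : ℝ) : 𝕜) :=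
  (exists_realPosPart f).choose_spec.1

theorem norm_realPosPart_le (f : F.carrier) : ‖realPosPart f‖ ≤ ‖f‖ :=
  (exists_realPosPart f).choose_spec.2

theorem isNonneg_realPosPart (f : F.carrier) : IsNonneg (realPosPart f) := by
  filter_upwards [coeFn_realPosPart f] with b hb
  rw [hb]
  exact RCLike.ofReal_nonneg.2 (le_max_right _ _)

theorem coeFn_neg (f : F.carrier) : ∀ᵐ b ∂ν, ((-f : F.carrier) : B →ₘ[ν] 𝕜) b =
    -(f : B →ₘ[ν] 𝕜) b :=
  AEEqFun.coeFn_neg (f : B →ₘ[ν] 𝕜)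

/-- This is `(f + g)⁺ - (f + g)⁻ = f⁺ - f⁻ + g⁺ - g⁻` for real parts, without subtraction, so that a
map additive only on the cone can be applied to both sides. -/
theorem realPosPart_add (f g : F.carrier) :
    realPosPart (f + g) + (realPosPart (-f) + realPosPart (-g)) =
      realPosPart f + realPosPart g + realPosPart (-(f + g)) := by
  refine ext_ae ?_
  filter_upwards [coeFn_add (realPosPart (f + g)) (realPosPart (-f) + realPosPart (-g)),
    coeFn_add (realPosPart (-f)) (realPosPart (-g)),
    coeFn_add (realPosPart f + realPosPart g) (realPosPart (-(f + g))),
    coeFn_add (realPosPart f) (realPosPart g), coeFn_realPosPart (f + g),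
    coeFn_realPosPart (-f), coeFn_realPosPart (-g), coeFn_realPosPart f, coeFn_realPosPart g,
    coeFn_realPosPart (-(f + g)), coeFn_add f g, coeFn_neg f, coeFn_neg g, coeFn_neg (f + g)]
    with b h1 h2 h3 h4 h5 h6 h7 h8 h9 h10 h11 h12 h13 h14
  rw [h1, h2, h3, h4, h5, h6, h7, h8, h9, h10, h14, h11, h12, h13]
  simp only [map_add (RCLike.re : 𝕜 →+ ℝ), map_neg (RCLike.re : 𝕜 →+ ℝ), ← RCLike.ofReal_add]
  congr 1
  have key : ∀ x : ℝ, max (-x) 0 = max x 0 - x := fun x => by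
    rcases le_total x 0 with h | h
    · rw [max_eq_left (by linarith), max_eq_right h]; ring
    · rw [max_eq_right (by linarith), max_eq_left h]; ring
  rw [key, key, key]
  ring

theorem realPosPart_of_nonneg {f : F.carrier} (hf : IsNonneg f) : realPosPart f = f := by
  refine ext_ae ?_
  filter_upwards [coeFn_realPosPart f, hf] with b h1 h2
  obtain ⟨h3, h4⟩ := RCLike.nonneg_iff.1 h2
  rw [h1, max_eq_left h3]
  exact RCLike.ext (by simp) (by simp [h4])

theorem realPosPart_eq_zero {f : F.carrier}
    (hf : ∀ᵐ b ∂ν, RCLike.re ((f : B →ₘ[ν] 𝕜) b) ≤ 0) : realPosPart f = 0 := by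
  refine ext_ae ?_
  filter_upwards [coeFn_realPosPart f, hf, coeFn_zero (E := F)] with b h1 h2 h3
  rw [h1, max_eq_right h2, h3, RCLike.ofReal_zero]

/-- Every element is a combination of nonnegative elements. -/
theorem eq_realPosPart (f : F.carrier) :
    f = realPosPart f - realPosPart (-f) - (RCLike.I : 𝕜) •
      (realPosPart ((RCLike.I : 𝕜) • f) - realPosPart (-((RCLike.I : 𝕜) • f))) := by
  refine ext_ae ?_
  filter_upwards [coeFn_sub (realPosPart f - realPosPart (-f)) ((RCLike.I : 𝕜) •
      (realPosPart ((RCLike.I : 𝕜) • f) - realPosPart (-((RCLike.I : 𝕜) • f)))),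
    coeFn_sub (realPosPart f) (realPosPart (-f)), coeFn_smul (RCLike.I : 𝕜)
      (realPosPart ((RCLike.I : 𝕜) • f) - realPosPart (-((RCLike.I : 𝕜) • f))),
    coeFn_sub (realPosPart ((RCLike.I : 𝕜) • f)) (realPosPart (-((RCLike.I : 𝕜) • f))),
    coeFn_realPosPart f, coeFn_realPosPart (-f), coeFn_realPosPart ((RCLike.I : 𝕜) • f),
    coeFn_realPosPart (-((RCLike.I : 𝕜) • f)), coeFn_neg f, coeFn_neg ((RCLike.I : 𝕜) • f),
    coeFn_smul (RCLike.I : 𝕜) f] with b h1 h2 h3 h4 h5 h6 h7 h8 h9 h10 h11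
  rw [h1, h2, h3, h4, h5, h6, h7, h8, h9, h10, h11]
  simp only [map_neg, ← RCLike.ofReal_sub]
  have key : ∀ x : ℝ, max x 0 - max (-x) 0 = x := fun x => by
    rcases le_total x 0 with h | h
    · rw [max_eq_left (by linarith : 0 ≤ -x), max_eq_right h]; ring
    · rw [max_eq_right (by linarith : -x ≤ 0), max_eq_left h]; ring
  rw [key, key]
  set z := (f : B →ₘ[ν] 𝕜) b
  -- Here `Re (I z) = -Im z`; over the reals `I = 0` and the second term disappears.
  refine RCLike.ext ?_ ?_
  · simp
  · rcases RCLike.I_eq_zero_or_im_I_eq_one (K := 𝕜) with h | h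
    · simp [h, RCLike.im_eq_zero h]
    · simp [h]

/-- Bounded linear operators that agree on the positive cone are equal. -/
theorem clm_ext_nonneg {Z : Type*} [NormedAddCommGroup Z] [NormedSpace 𝕜 Z]
    {U V : F.carrier →L[𝕜] Z} (h : ∀ f, IsNonneg f → U f = V f) : U = V := by
  ext f
  rw [eq_realPosPart f]
  simp only [map_sub, map_smul, h _ (isNonneg_realPosPart _)]

/-- A bounded additive map on the positive cone extends to a bounded linear operator. -/
theorem exists_clm_of_nonneg {Z : Type*} [NormedAddCommGroup Z] [NormedSpace 𝕜 Z]
    (p : F.carrier → Z) (hadd : ∀ f g, IsNonneg f → IsNonneg g → p (f + g) = p f + p g) {C : ℝ}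
    (hC : ∀ f, IsNonneg f → ‖p f‖ ≤ C * ‖f‖) :
    ∃ U : F.carrier →L[𝕜] Z, ∀ f, IsNonneg f → U f = p f := by
  have h0n : IsNonneg (0 : F.carrier) := by
    filter_upwards [coeFn_zero (E := F)] with b hb
    rw [hb]
  have hp0 : p 0 = 0 := by
    have := hadd 0 0 h0n h0n
    rw [add_zero] at this
    simpa using this
  have hCb : ∀ f : F.carrier, ‖p (realPosPart f)‖ ≤ max C 0 * ‖f‖ := fun f =>
    (hC _ (isNonneg_realPosPart f)).trans (mul_le_mul (le_max_left _ _) (norm_realPosPart_le f)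
      (norm_nonneg _) (le_max_right _ _))
  -- `P f` depends only on the real part of `f`, and is the difference of `p` at its positive and
  -- negative parts.
  let P : F.carrier →+ Z := AddMonoidHom.mk' (fun f => p (realPosPart f) - p (realPosPart (-f)))
    fun f g => by
      have hn := fun f : F.carrier => isNonneg_realPosPart f
      have h1 := congrArg p (realPosPart_add f g)
      rw [hadd _ _ (hn _) ((hn _).add (hn _)), hadd _ _ (hn _) (hn _),
        hadd _ _ ((hn _).add (hn _)) (hn _), hadd _ _ (hn _) (hn _)] at h1
      have h2 : p (realPosPart (f + g)) = p (realPosPart f) + p (realPosPart g) +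
        p (realPosPart (-(f + g))) - (p (realPosPart (-f)) + p (realPosPart (-g))) :=
        eq_sub_of_add_eq h1
      rw [h2]
      abel
  have hPapp : ∀ f, P f = p (realPosPart f) - p (realPosPart (-f)) := fun _ => rfl
  have hPb : ∀ f, ‖P f‖ ≤ 2 * max C 0 * ‖f‖ := fun f => by
    have h1 := hCb f
    have h2 := hCb (-f)
    rw [norm_neg] at h2
    have h3 := norm_sub_le (p (realPosPart f)) (p (realPosPart (-f)))
    rw [hPapp]
    linarith
  have hPc : Continuous P := AddMonoidHomClass.continuous_of_bound P _ hPb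
  have hPr : ∀ (c : ℝ) (f : F.carrier), P ((c : 𝕜) • f) = (c : 𝕜) • P f := fun c f =>
    hPc.map_ofReal_smul c f
  have hI : ∀ f, P ((RCLike.I : 𝕜) • f) - (RCLike.I : 𝕜) • P ((RCLike.I : 𝕜) • (RCLike.I : 𝕜) • f) =
      (RCLike.I : 𝕜) • (P f - (RCLike.I : 𝕜) • P ((RCLike.I : 𝕜) • f)) := fun f => by
    rcases RCLike.I_mul_I (K := 𝕜) with h | h
    · simp [h]
    · simp only [smul_sub, smul_smul, h, neg_one_smul, map_neg]
      simp only [smul_neg, sub_neg_eq_add]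
      abel
  -- Complexification: since `Re (I f) = -Im f`, the term `-I • P (I f)` accounts for the imaginary
  -- part of `f`. Over the reals `I = 0` and only `P` remains.
  let L : F.carrier →ₗ[𝕜] Z :=
    { toFun := fun f => P f - (RCLike.I : 𝕜) • P ((RCLike.I : 𝕜) • f)
      map_add' := fun f g => by
        rw [map_add, smul_add, map_add, smul_add]
        abel
      map_smul' := fun c f => by
        have hr : ∀ (r : ℝ) (f : F.carrier), P ((r : 𝕜) • f) -
            (RCLike.I : 𝕜) • P ((RCLike.I : 𝕜) • (r : 𝕜) • f) =
            (r : 𝕜) • (P f - (RCLike.I : 𝕜) • P ((RCLike.I : 𝕜) • f)) := fun r f => by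
          rw [smul_comm (RCLike.I : 𝕜) (r : 𝕜) f, hPr, hPr, smul_sub, smul_comm]
        have hc : c • f = ((RCLike.re c : ℝ) : 𝕜) • f +
            ((RCLike.im c : ℝ) : 𝕜) • (RCLike.I : 𝕜) • f := by
          rw [smul_smul, ← add_smul, RCLike.re_add_im]
        have h1 := hr (RCLike.re c) f
        have h2 := hr (RCLike.im c) ((RCLike.I : 𝕜) • f)
        rw [hI] at h2
        simp only [RingHom.id_apply]
        calc _ = (P (((RCLike.re c : ℝ) : 𝕜) • f) - (RCLike.I : 𝕜) •
                P ((RCLike.I : 𝕜) • ((RCLike.re c : ℝ) : 𝕜) • f)) +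
              (P (((RCLike.im c : ℝ) : 𝕜) • (RCLike.I : 𝕜) • f) - (RCLike.I : 𝕜) •
                P ((RCLike.I : 𝕜) • ((RCLike.im c : ℝ) : 𝕜) • (RCLike.I : 𝕜) • f)) := by
              rw [hc, map_add, smul_add, map_add, smul_add]
              abel
          _ = _ := by
              rw [h1, h2, smul_smul, ← add_smul, RCLike.re_add_im] }
  have hIn : ‖(RCLike.I : 𝕜)‖ ≤ 1 := by
    by_cases h : (RCLike.I : 𝕜) = 0
    · simp [h]
    · rw [RCLike.norm_I_of_ne_zero h]
  refine ⟨L.mkContinuous (2 * max C 0 + 2 * max C 0) fun f => ?_, fun f hf => ?_⟩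
  · change ‖P f - (RCLike.I : 𝕜) • P ((RCLike.I : 𝕜) • f)‖ ≤ _
    refine (norm_sub_le _ _).trans ?_
    rw [add_mul]
    refine add_le_add (hPb f) ?_
    have h1 : ‖(RCLike.I : 𝕜) • f‖ ≤ ‖f‖ := by
      rw [norm_smul]; exact mul_le_of_le_one_left (norm_nonneg _) hIn
    have h2 : 0 ≤ 2 * max C 0 := by positivity
    rw [norm_smul]
    exact (mul_le_of_le_one_left (norm_nonneg _) hIn).trans
      ((hPb _).trans (mul_le_mul_of_nonneg_left h1 h2))
  · change P f - (RCLike.I : 𝕜) • P ((RCLike.I : 𝕜) • f) = p f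
    have h1 : realPosPart (-f) = 0 := realPosPart_eq_zero (by
      filter_upwards [hf, coeFn_neg f] with b h1 h2
      rw [h2, map_neg, neg_nonpos]
      exact (RCLike.nonneg_iff.1 h1).1)
    have h2 : ∀ᵐ b ∂ν, RCLike.re ((((RCLike.I : 𝕜) • f : F.carrier) : B →ₘ[ν] 𝕜) b) = 0 := by
      filter_upwards [hf, coeFn_smul (RCLike.I : 𝕜) f] with b h1 h2
      rw [h2]
      simp [(RCLike.nonneg_iff.1 h1).2]
    have h3 : realPosPart ((RCLike.I : 𝕜) • f) = 0 :=
      realPosPart_eq_zero (h2.mono fun b hb => hb.le)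
    have h4 : realPosPart (-((RCLike.I : 𝕜) • f)) = 0 := realPosPart_eq_zero (by
      filter_upwards [h2, coeFn_neg ((RCLike.I : 𝕜) • f)] with b h1 h2
      rw [h2, map_neg, h1, neg_zero])
    rw [hPapp, hPapp, h1, h3, h4, realPosPart_of_nonneg hf, hp0]
    simp

end BanachFunctionSpace

end Cone

/-! ### Regular and dominated operators into `L¹` coincide. -/

section Regular

variable {𝕜 : Type*} [RCLike 𝕜] {A : Type*} [MeasurableSpace A] {μ : Measure A}
  {B : Type*} [MeasurableSpace B] {ν : Measure B} {F : BanachFunctionSpace 𝕜 ν}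

open BanachFunctionSpace

theorem BanachFunctionSpace.exists_realPart (f : F.carrier) : ∃ g : F.carrier,
    ∀ᵐ b ∂ν, (g : B →ₘ[ν] 𝕜) b = ((RCLike.re ((f : B →ₘ[ν] 𝕜) b) : ℝ) : 𝕜) := by
  obtain ⟨g, hg, -⟩ := F.exists_ae_eq
    (f := fun b => ((RCLike.re ((f : B →ₘ[ν] 𝕜) b) : ℝ) : 𝕜))
    ((RCLike.continuous_ofReal.comp RCLike.continuous_re).comp_aestronglyMeasurable
      (AEEqFun.aestronglyMeasurable (f : B →ₘ[ν] 𝕜))) f (ae_of_all _ fun b => by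
        rw [RCLike.norm_ofReal]; exact RCLike.abs_re_le_norm _)
  exact ⟨g, hg⟩

/-- A positive operator maps real functions to real functions. -/
theorem IsPositiveOp.ae_im_eq_zero {R : F.carrier →L[𝕜] Lp 𝕜 1 μ} (hR : IsPositiveOp R)
    {e : F.carrier} (he : ∀ᵐ b ∂ν, RCLike.im ((e : B →ₘ[ν] 𝕜) b) = 0) :
    ∀ᵐ a ∂μ, RCLike.im (R e a) = 0 := by
  obtain ⟨m, hm, -⟩ := exists_modulus e
  have h1 := hR m (by
    filter_upwards [hm] with b hb
    rw [hb]; exact RCLike.ofReal_nonneg.2 (norm_nonneg _))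
  -- The order of `𝕜` compares only numbers with equal imaginary parts, so `R e ≤ R |e|` forces `R
  -- e` to be real like `R |e|`.
  have h2 := hR.ae_le (e := e) (g := m) (by
    filter_upwards [hm, he] with b h1 h2
    rw [h1, RCLike.le_iff_re_im]
    simp [h2, RCLike.re_le_norm])
  filter_upwards [h1, h2] with a h3 h4
  rw [(RCLike.le_iff_re_im.1 h4).2, (RCLike.nonneg_iff.1 h3).2]

/-- For unimodular `θ`, `Re (θ R e) = R (Re (θ e)) ≤ R |e|` because `R` preserves real functions;
the supremum over `θ` is `|R e|`. -/
theorem IsPositiveOp.isDominant {R : F.carrier →L[𝕜] Lp 𝕜 1 μ} (hR : IsPositiveOp R) :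
    IsDominant R R := by
  refine ⟨hR, fun e m hm => ?_⟩
  have hθ : ∀ θ : 𝕜, ‖θ‖ = 1 → ∀ᵐ a ∂μ, RCLike.re (θ * R e a) ≤ RCLike.re (R m a) := by
    intro θ hθ
    obtain ⟨p, hp⟩ := exists_realPart (θ • e)
    -- The imaginary part of `θ e`, written as the real part of `-I θ e`.
    obtain ⟨q, hq⟩ := exists_realPart (-((RCLike.I : 𝕜) • (θ • e)))
    have hpq : θ • e = p + (RCLike.I : 𝕜) • q := ext_ae (by
      filter_upwards [hp, hq, coeFn_neg ((RCLike.I : 𝕜) • (θ • e)),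
        coeFn_smul (RCLike.I : 𝕜) (θ • e), coeFn_add p ((RCLike.I : 𝕜) • q),
        coeFn_smul (RCLike.I : 𝕜) q] with b h1 h2 h3 h4 h5 h6
      rw [h5, h6, h1, h2, h3, h4]
      set z := ((θ • e : F.carrier) : B →ₘ[ν] 𝕜) b
      refine RCLike.ext ?_ ?_
      · simp
      · rcases RCLike.I_eq_zero_or_im_I_eq_one (K := 𝕜) with h | h
        · simp [h, RCLike.im_eq_zero h]
        · simp [h])
    have hqi := hR.ae_im_eq_zero (e := q) (by
      filter_upwards [hq] with b hb
      rw [hb, RCLike.ofReal_im])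
    have hpm := hR.ae_le (e := p) (g := m) (by
      filter_upwards [hp, hm, coeFn_smul θ e] with b h1 h2 h3
      rw [h1, h2]
      refine RCLike.ofReal_le_ofReal.2 ((RCLike.re_le_norm _).trans (le_of_eq ?_))
      rw [h3, norm_mul, hθ, one_mul])
    have hRe : θ • R e = R p + (RCLike.I : 𝕜) • R q := by
      rw [← map_smul, hpq, map_add, map_smul]
    filter_upwards [hqi, hpm, Lp.coeFn_smul θ (R e), Lp.coeFn_add (R p) ((RCLike.I : 𝕜) • R q),
      Lp.coeFn_smul (RCLike.I : 𝕜) (R q)] with a h1 h2 h3 h4 h5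
    have h6 : θ * R e a = R p a + (RCLike.I : 𝕜) * R q a := by
      rw [← smul_eq_mul, ← Pi.smul_apply, ← h3, hRe, h4, Pi.add_apply, h5, Pi.smul_apply,
        smul_eq_mul]
    rw [h6]
    simpa [h1] using (RCLike.le_iff_re_im.1 h2).1
  have h1 := ae_forall_unimodular (μ := μ) (u := fun a (θ : Metric.sphere (0 : 𝕜) 1) =>
    RCLike.re ((θ : 𝕜) * R e a)) (c := fun a => RCLike.re (R m a))
    (fun a => by fun_prop) (fun θ => hθ θ (by simp))
  have h2 := hR m (by
    filter_upwards [hm] with b hb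
    rw [hb]; exact RCLike.ofReal_nonneg.2 (norm_nonneg _))
  filter_upwards [h1, h2] with a h3 h4
  have h5 : ‖R e a‖ ≤ RCLike.re (R m a) :=
    norm_le_of_forall_unimodular fun θ hθ => h3 ⟨θ, by simpa using hθ⟩
  rw [RCLike.le_iff_re_im]
  simp [h5, (RCLike.nonneg_iff.1 h4).2]

theorem IsDominant.add {T T' R R' : F.carrier →L[𝕜] Lp 𝕜 1 μ} (h : IsDominant T R)
    (h' : IsDominant T' R') : IsDominant (T + T') (R + R') := by
  refine ⟨fun e he => ?_, fun e m hm => ?_⟩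
  · filter_upwards [h.1 e he, h'.1 e he, Lp.coeFn_add (R e) (R' e)] with a h1 h2 h3
    rw [add_apply, h3]
    exact add_nonneg h1 h2
  · filter_upwards [h.2 e m hm, h'.2 e m hm, Lp.coeFn_add (R m) (R' m), Lp.coeFn_add (T e) (T' e)]
      with a h1 h2 h3 h4
    rw [add_apply, add_apply, h3, h4]
    refine le_trans ?_ (add_le_add h1 h2)
    rw [← RCLike.ofReal_add]
    exact RCLike.ofReal_le_ofReal.2 (norm_add_le _ _)

theorem IsDominant.smul {T R : F.carrier →L[𝕜] Lp 𝕜 1 μ} (h : IsDominant T R) (c : 𝕜) :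
    IsDominant (c • T) (((‖c‖ : ℝ) : 𝕜) • R) := by
  have hc : (0 : 𝕜) ≤ ((‖c‖ : ℝ) : 𝕜) := RCLike.ofReal_nonneg.2 (norm_nonneg _)
  refine ⟨fun e he => ?_, fun e m hm => ?_⟩
  · filter_upwards [h.1 e he, Lp.coeFn_smul ((‖c‖ : ℝ) : 𝕜) (R e)] with a h1 h2
    rw [smul_apply, h2]
    exact mul_nonneg hc h1
  · filter_upwards [h.2 e m hm, Lp.coeFn_smul ((‖c‖ : ℝ) : 𝕜) (R m), Lp.coeFn_smul c (T e)]
      with a h1 h2 h3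
    rw [smul_apply, smul_apply, h2, h3, Pi.smul_apply, Pi.smul_apply, norm_smul, RCLike.ofReal_mul]
    exact mul_le_mul_of_nonneg_left h1 hc

theorem IsRegularOp.isDominated {U : F.carrier →L[𝕜] Lp 𝕜 1 μ} (hU : IsRegularOp U) :
    IsDominated U := by
  refine Submodule.span_induction (p := fun U _ => IsDominated U) ?_ ?_ ?_ ?_ hU
  · exact fun R hR => ⟨R, IsPositiveOp.isDominant hR⟩
  · refine ⟨0, IsPositiveOp.isDominant fun e _ => ?_⟩
    filter_upwards [Lp.coeFn_zero 𝕜 1 μ] with a ha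
    exact ha.symm.le
  · rintro _ _ - - ⟨R, hR⟩ ⟨R', hR'⟩
    exact ⟨_, hR.add hR'⟩
  · rintro c _ - ⟨R, hR⟩
    exact ⟨_, hR.smul c⟩

/-- An operator that is dominated by `R` and real on the positive cone is regular. -/
theorem IsPositiveOp.isRegularOp_of_le {R V : F.carrier →L[𝕜] Lp 𝕜 1 μ} (hR : IsPositiveOp R)
    (hV : ∀ e, IsNonneg e → ∀ᵐ a ∂μ, V e a ≤ R e a) : IsRegularOp V := by
  have h1 : V = R - (R - V) := (sub_sub_cancel R V).symm
  rw [h1]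
  refine Submodule.sub_mem _ (Submodule.subset_span hR) (Submodule.subset_span fun e he => ?_)
  filter_upwards [hV e he, Lp.coeFn_sub (R e) (V e)] with a h2 h3
  rw [sub_apply, h3]
  exact sub_nonneg.2 h2

/-- A real-linear contraction of the values of `U` induces an operator. -/
theorem exists_realValued_part (U : F.carrier →L[𝕜] Lp 𝕜 1 μ) (ρ : 𝕜 →+ ℝ) (hρc : Continuous ρ)
    (hρ : ∀ z, |ρ z| ≤ ‖z‖) :
    ∃ V : F.carrier →L[𝕜] Lp 𝕜 1 μ, ∀ e, IsNonneg e →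
      ∀ᵐ a ∂μ, V e a = ((ρ (U e a) : ℝ) : 𝕜) := by
  have hm : ∀ e : F.carrier, MemLp (fun a => ((ρ (U e a) : ℝ) : 𝕜)) 1 μ := fun e =>
    (Lp.memLp (U e)).mono
      ((RCLike.continuous_ofReal.comp hρc).comp_aestronglyMeasurable (Lp.aestronglyMeasurable _))
      (ae_of_all _ fun a => by rw [RCLike.norm_ofReal]; exact hρ _)
  have hm' : ∀ e, ∀ᵐ a ∂μ, (hm e).toLp _ a = ((ρ (U e a) : ℝ) : 𝕜) := fun e => (hm e).coeFn_toLp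
  -- The map `e ↦ ρ (U e)` is additive but need not be `𝕜`-linear, so only its values on the cone
  -- are kept.
  obtain ⟨V, hV⟩ := exists_clm_of_nonneg (F := F) (fun e => (hm e).toLp _) (C := ‖U‖)
    (fun f g _ _ => Lp.ext (by
      filter_upwards [hm' (f + g), hm' f, hm' g, Lp.coeFn_add ((hm f).toLp _) ((hm g).toLp _),
        Lp.coeFn_add (U f) (U g)] with a h1 h2 h3 h4 h5
      rw [h1, h4, Pi.add_apply, h2, h3, map_add U, h5, Pi.add_apply, map_add ρ, RCLike.ofReal_add]))
    (fun f _ => le_trans (Lp.norm_le_norm_of_ae_le (by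
      filter_upwards [hm' f] with a ha
      rw [ha, RCLike.norm_ofReal]
      exact hρ _)) (U.le_opNorm f))
  refine ⟨V, fun e he => ?_⟩
  rw [hV e he]
  exact hm' e

/-- On the cone, `U` splits into the real and imaginary parts of its values. Both are at most `|U e|
≤ R e`, so each extends to a difference of positive operators. -/
theorem IsDominated.isRegularOp {U : F.carrier →L[𝕜] Lp 𝕜 1 μ} (hU : IsDominated U) :
    IsRegularOp U := by
  obtain ⟨R, hR⟩ := hU
  obtain ⟨V, hV⟩ := exists_realValued_part U RCLike.re RCLike.continuous_re RCLike.abs_re_le_norm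
  obtain ⟨W, hW⟩ := exists_realValued_part U RCLike.im RCLike.continuous_im RCLike.abs_im_le_norm
  have hle : ∀ e, IsNonneg e → ∀ᵐ a ∂μ, ((‖U e a‖ : ℝ) : 𝕜) ≤ R e a := fun e he => by
    refine hR.2 e e ?_
    filter_upwards [he] with b hb
    obtain ⟨r, h0, hr⟩ := RCLike.nonneg_iff_exists_ofReal.1 hb
    rw [← hr, RCLike.norm_ofReal, abs_of_nonneg h0]
  have hUVW : U = V + (RCLike.I : 𝕜) • W := clm_ext_nonneg fun e he => Lp.ext (by
    filter_upwards [hV e he, hW e he, Lp.coeFn_add (V e) ((RCLike.I : 𝕜) • W e),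
      Lp.coeFn_smul (RCLike.I : 𝕜) (W e)] with a h1 h2 h3 h4
    rw [add_apply, smul_apply, h3, Pi.add_apply, h4, Pi.smul_apply, h1, h2, smul_eq_mul,
      mul_comm, RCLike.re_add_im])
  rw [hUVW]
  refine Submodule.add_mem _ (hR.1.isRegularOp_of_le fun e he => ?_)
    (Submodule.smul_mem _ _ (hR.1.isRegularOp_of_le fun e he => ?_))
  · filter_upwards [hV e he, hle e he] with a h1 h2
    rw [h1]
    exact (RCLike.ofReal_le_ofReal.2 (RCLike.re_le_norm _)).trans h2
  · filter_upwards [hW e he, hle e he] with a h1 h2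
    rw [h1]
    exact (RCLike.ofReal_le_ofReal.2 (RCLike.im_le_norm _)).trans h2

end Regular

/-! ### Suprema in `L¹`. -/

section LOneLattice

variable {A : Type*} [MeasurableSpace A] {μ : Measure A}

theorem integralCLM_eq_norm {u : Lp ℝ 1 μ} (hu : 0 ≤ u) : L1.integralCLM u = ‖u‖ := by
  rw [← L1.integral_eq, L1.integral_eq_integral, L1.norm_eq_integral_norm]
  refine integral_congr_ae ?_
  filter_upwards [(Lp.coeFn_nonneg u).2 hu] with a ha
  exact (Real.norm_of_nonneg ha).symm

/-- A nonempty family in `L¹` whose finite suprema have bounded integrals has a supremum. -/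
theorem exists_isLUB_lOne {D : Set (Lp ℝ 1 μ)} (hne : D.Nonempty) (hD : SupClosed D) {C : ℝ}
    (hC : ∀ u ∈ D, L1.integralCLM u ≤ C) : ∃ w, IsLUB D w ∧ L1.integralCLM w ≤ C := by
  set J : Lp ℝ 1 μ →L[ℝ] ℝ := L1.integralCLM with hJ
  have hmono : ∀ {u v : Lp ℝ 1 μ}, u ≤ v → J u ≤ J v := fun {u v} huv => by
    have := integralCLM_eq_norm (sub_nonneg.2 huv)
    rw [map_sub] at this
    linarith [norm_nonneg (v - u)]
  have hbdd : BddAbove (J '' D) := ⟨C, by rintro _ ⟨u, hu, rfl⟩; exact hC u hu⟩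
  -- Exhaustion: take a sequence in `D` whose integrals tend to their supremum and pass to its
  -- partial suprema, which remain in `D`.
  obtain ⟨r, -, hr, hrD⟩ := exists_seq_tendsto_sSup (hne.image J) hbdd
  choose u huD hu using hrD
  have hvD : ∀ n, partialSups u n ∈ D := fun n => by
    induction n with
    | zero => simpa using huD 0
    | succ n ih => rw [partialSups_add_one]; exact hD ih (huD _)
  set c := sSup (J '' D) with hc
  have hJc : ∀ u ∈ D, J u ≤ c := fun u hu => le_csSup hbdd ⟨u, hu, rfl⟩
  have hvc : Tendsto (fun n => J (partialSups u n)) atTop (𝓝 c) :=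
    tendsto_of_tendsto_of_tendsto_of_le_of_le hr tendsto_const_nhds
      (fun n => by rw [← hu n]; exact hmono (le_partialSups u n)) (fun n => hJc _ (hvD n))
  have hcauchy : CauchySeq (fun n => partialSups u n) := by
    -- For an increasing sequence the `L¹` distance is the difference of the integrals; the factor
    -- `2` comes from comparing through index `N`.
    refine cauchySeq_of_le_tendsto_0 (fun n => 2 * (c - J (partialSups u n))) ?_ ?_
    · have hN : ∀ n N, N ≤ n → dist (partialSups u n) (partialSups u N) ≤
          c - J (partialSups u N) := fun n N hn => by
        rw [dist_eq_norm, ← integralCLM_eq_norm (sub_nonneg.2 ((partialSups u).mono hn)), map_sub]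
        linarith [hJc _ (hvD n)]
      intro n m N hn hm
      have h1 := dist_triangle_right (partialSups u n) (partialSups u m) (partialSups u N)
      linarith [hN n N hn, hN m N hm]
    · simpa using (hvc.const_sub c).const_mul 2
  obtain ⟨w, hw⟩ := cauchySeq_tendsto_of_complete hcauchy
  have hJw : J w = c := tendsto_nhds_unique ((J.continuous.tendsto w).comp hw) hvc
  refine ⟨w, ⟨fun z hz => ?_, fun z hz => ?_⟩, ?_⟩
  · have h1 : Tendsto (fun n => z ⊔ partialSups u n) atTop (𝓝 (z ⊔ w)) :=
      tendsto_const_nhds.sup_nhds hw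
    -- The integral of `z ⊔ w` cannot exceed the maximum `c = J w`, so `z ⊔ w = w`.
    have h2 : J (z ⊔ w) ≤ c := le_of_tendsto' ((J.continuous.tendsto _).comp h1)
      fun n => hJc _ (hD hz (hvD n))
    have h3 := integralCLM_eq_norm (sub_nonneg.2 (le_sup_right : w ≤ z ⊔ w))
    rw [map_sub, ← hJ, hJw] at h3
    have h4 : ‖z ⊔ w - w‖ = 0 := le_antisymm (by linarith) (norm_nonneg _)
    rw [norm_eq_zero, sub_eq_zero] at h4
    exact h4 ▸ le_sup_left
  · exact le_of_tendsto' hw fun n => hz (hvD n)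
  · rw [hJw]
    exact csSup_le (hne.image J) (by rintro _ ⟨u, hu, rfl⟩; exact hC u hu)

end LOneLattice

/-! ### The modulus of `S` as its dominant. -/

section Modulus

variable {𝕜 : Type*} [RCLike 𝕜] {A : Type*} [MeasurableSpace A] {μ : Measure A}
  {B : Type*} [MeasurableSpace B] {ν : Measure B} {F G : BanachFunctionSpace 𝕜 ν}

open BanachFunctionSpace

/-- The class of `a ↦ ‖u a‖` in the real space `L¹`. -/
noncomputable def normLp (u : Lp 𝕜 1 μ) : Lp ℝ 1 μ := (Lp.memLp u).norm.toLp _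

theorem coeFn_normLp (u : Lp 𝕜 1 μ) : ∀ᵐ a ∂μ, normLp u a = ‖u a‖ :=
  (Lp.memLp u).norm.coeFn_toLp

theorem IsDominant.ae_le_indLp {T R : Lp 𝕜 ∞ μ →L[𝕜] G.carrier} (hR : IsDominant T R) {s : Set A}
    (hs : MeasurableSet s) {h : Lp 𝕜 ∞ μ} (hh : ∀ᵐ a ∂μ, ‖h a‖ ≤ s.indicator (fun _ => (1 : ℝ)) a) :
    ∀ᵐ b ∂ν, ‖(T h : B →ₘ[ν] 𝕜) b‖ ≤ RCLike.re ((R (indLp 𝕜 μ hs) : B →ₘ[ν] 𝕜) b) := by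
  have hm : MemLp (fun a => ((‖h a‖ : ℝ) : 𝕜)) ∞ μ := (Lp.memLp h).norm.ofReal
  have hm' : ∀ᵐ a ∂μ, hm.toLp _ a = ((‖h a‖ : ℝ) : 𝕜) := hm.coeFn_toLp
  have h1 := hR.2 h (hm.toLp _) hm'
  have h2 := hR.1 (indLp 𝕜 μ hs - hm.toLp _) (by
    filter_upwards [hm', hh, Lp.coeFn_sub (indLp 𝕜 μ hs) (hm.toLp _),
      coeFn_indLp (𝕜 := 𝕜) (μ := μ) hs] with a h1 h2 h3 h4
    rw [h3, Pi.sub_apply, h1, h4]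
    refine sub_nonneg.2 (le_trans (RCLike.ofReal_le_ofReal.2 h2) (le_of_eq ?_))
    by_cases ha : a ∈ s <;> simp [ha])
  rw [map_sub] at h2
  filter_upwards [h1, h2, coeFn_sub (R (indLp 𝕜 μ hs)) (R (hm.toLp _))] with b h3 h4 h5
  rw [h5, sub_nonneg] at h4
  simpa using (RCLike.le_iff_re_im.1 (h3.trans h4)).1

/-- The left side is `⟨g, T k⟩`, where `k` is the sign of `S g` cut off to `s`, and `|T k| ≤ R 1_s`.
The bound is additive in `s` and the same for all `g` with `|g| ≤ m`. -/
theorem IsKoetheAdjoint.setIntegral_norm_le {hFG : IsKoetheDualPair F G}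
    {T : Lp 𝕜 ∞ μ →L[𝕜] G.carrier} {S : F.carrier →L[𝕜] Lp 𝕜 1 μ} (hS : IsKoetheAdjoint hFG T S)
    {R : Lp 𝕜 ∞ μ →L[𝕜] G.carrier} (hR : IsDominant T R) {g m : F.carrier}
    (hg : ∀ᵐ b ∂ν, ((‖(g : B →ₘ[ν] 𝕜) b‖ : ℝ) : 𝕜) ≤ (m : B →ₘ[ν] 𝕜) b)
    {s : Set A} (hs : MeasurableSet s) :
    ∫ a in s, ‖S g a‖ ∂μ ≤ RCLike.re (hFG.pairing m (R (indLp 𝕜 μ hs))) := by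
  obtain ⟨h₀, -, h1, h2⟩ := exists_sign_lOne (S g)
  have hm : MemLp (s.indicator h₀) ∞ μ := (Lp.memLp h₀).indicator hs
  have hm' : ∀ᵐ a ∂μ, hm.toLp _ a = s.indicator h₀ a := hm.coeFn_toLp
  have h3 : ((∫ a in s, ‖S g a‖ ∂μ : ℝ) : 𝕜) = hFG.pairing g (T (hm.toLp _)) := by
    rw [← hS, lOneLInftyPairing_apply, ← integral_indicator hs, ← integral_ofReal]
    refine integral_congr_ae ?_
    filter_upwards [hm', h2] with a h4 h5
    rw [ContinuousLinearMap.mul_apply', h4]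
    by_cases ha : a ∈ s
    · simp [ha, h5]
    · simp [ha]
  have h4 := hR.ae_le_indLp (ν := ν) hs (h := hm.toLp _) (by
    filter_upwards [hm', h1] with a h4 h5
    rw [h4]
    by_cases ha : a ∈ s <;> simp [ha, h5])
  calc ∫ a in s, ‖S g a‖ ∂μ ≤ ‖((∫ a in s, ‖S g a‖ ∂μ : ℝ) : 𝕜)‖ := by
        rw [RCLike.norm_ofReal]; exact le_abs_self _
    _ ≤ ∫ b, RCLike.re ((m : B →ₘ[ν] 𝕜) b * (R (indLp 𝕜 μ hs) : B →ₘ[ν] 𝕜) b) ∂ν := by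
        rw [h3, IsKoetheDualPair.pairing_apply]
        refine norm_integral_le_of_norm_le (hFG.integrable m (R (indLp 𝕜 μ hs))).re ?_
        filter_upwards [hg, h4] with b h5 h6
        obtain ⟨h7, h8⟩ := RCLike.le_iff_re_im.1 h5
        rw [RCLike.ofReal_re] at h7
        rw [RCLike.ofReal_im] at h8
        rw [norm_mul, RCLike.mul_re, ← h8, zero_mul, sub_zero]
        exact mul_le_mul h7 h6 (norm_nonneg _) ((norm_nonneg _).trans h7)
    _ = RCLike.re (hFG.pairing m (R (indLp 𝕜 μ hs))) :=
        integral_re (hFG.integrable m (R (indLp 𝕜 μ hs)))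

/-- The moduli of the values of `S` on the order interval of `f`. -/
def orderIntervalModuli (S : F.carrier →L[𝕜] Lp 𝕜 1 μ) (f : F.carrier) : Set (Lp ℝ 1 μ) :=
  {u | ∃ g : F.carrier, (∀ᵐ b ∂ν, ‖(g : B →ₘ[ν] 𝕜) b‖ ≤ ‖(f : B →ₘ[ν] 𝕜) b‖) ∧ u = normLp (S g)}

theorem zero_mem_orderIntervalModuli (S : F.carrier →L[𝕜] Lp 𝕜 1 μ) (f : F.carrier) :
    0 ∈ orderIntervalModuli S f := by
  refine ⟨0, ?_, ?_⟩
  · filter_upwards [coeFn_zero (E := F)] with b hb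
    rw [hb, norm_zero]
    exact norm_nonneg _
  · refine Lp.ext ?_
    filter_upwards [coeFn_normLp (S 0), Lp.coeFn_zero 𝕜 1 μ, Lp.coeFn_zero ℝ 1 μ] with a h1 h2 h3
    rw [h1, map_zero, h2, h3]
    simp

/-- The functions in `L¹` whose indefinite integrals are dominated by an additive set function are
stable under suprema. -/
theorem supClosed_setIntegral_le {m : Set A → ℝ}
    (hm : ∀ s t, MeasurableSet s → MeasurableSet t → m s = m (s ∩ t) + m (s \ t)) :
    SupClosed {u : Lp ℝ 1 μ | ∀ s, MeasurableSet s → ∫ a in s, u a ∂μ ≤ m s} := by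
  intro u hu v hv s hs
  -- Any `s` splits along this set: `u ⊔ v` is `u` on it and `v` off it.
  have ht : MeasurableSet {a | v a ≤ u a} :=
    (Lp.stronglyMeasurable v).measurableSet_le (Lp.stronglyMeasurable u)
  rw [hm s _ hs ht, ← integral_inter_add_sdiff ht (L1.integrable_coeFn (u ⊔ v)).integrableOn]
  refine add_le_add (le_trans (le_of_eq ?_) (hu _ (hs.inter ht)))
    (le_trans (le_of_eq ?_) (hv _ (hs.diff ht)))
  · refine setIntegral_congr_ae (hs.inter ht) ?_
    filter_upwards [Lp.coeFn_sup u v] with a h1 h2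
    rw [h1, Pi.sup_apply]
    exact sup_eq_left.2 h2.2
  · refine setIntegral_congr_ae (hs.diff ht) ?_
    filter_upwards [Lp.coeFn_sup u v] with a h1 h2
    rw [h1, Pi.sup_apply]
    exact sup_eq_right.2 (not_le.1 h2.2).le

/-- All moduli, and so all their finite suprema, have indefinite integrals below `s ↦ ⟨|f|, R 1_s⟩`;
its value at the whole space bounds the integrals. The constant is independent of `f`, as is needed
for a bounded operator. -/
theorem IsKoetheAdjoint.exists_isLUB {hFG : IsKoetheDualPair F G}
    {T : Lp 𝕜 ∞ μ →L[𝕜] G.carrier} {S : F.carrier →L[𝕜] Lp 𝕜 1 μ} (hS : IsKoetheAdjoint hFG T S)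
    (hT : IsDominated T) :
    ∃ C : ℝ, ∀ f, ∃ w, IsLUB (orderIntervalModuli S f) w ∧ ‖w‖ ≤ C * ‖f‖ := by
  obtain ⟨R, hR⟩ := hT
  obtain ⟨C, hC⟩ := hFG.bounded
  refine ⟨max C 0 * ‖R‖, fun f => ?_⟩
  obtain ⟨m, hm, hmn⟩ := exists_modulus f
  classical
  let M : Set A → ℝ := fun s => if hs : MeasurableSet s then
    RCLike.re (hFG.pairing m (R (indLp 𝕜 μ hs))) else 0
  have hM : ∀ s (hs : MeasurableSet s), M s = RCLike.re (hFG.pairing m (R (indLp 𝕜 μ hs))) :=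
    fun s hs => dif_pos hs
  have hMadd : ∀ s t, MeasurableSet s → MeasurableSet t → M s = M (s ∩ t) + M (s \ t) := by
    intro s t hs ht
    have h1 : indLp 𝕜 μ hs = indLp 𝕜 μ (hs.inter ht) + indLp 𝕜 μ (hs.diff ht) := by
      refine Lp.ext ?_
      filter_upwards [coeFn_indLp (𝕜 := 𝕜) (μ := μ) hs,
        coeFn_indLp (𝕜 := 𝕜) (μ := μ) (hs.inter ht), coeFn_indLp (𝕜 := 𝕜) (μ := μ) (hs.diff ht),
        Lp.coeFn_add (indLp 𝕜 μ (hs.inter ht)) (indLp 𝕜 μ (hs.diff ht))] with a h1 h2 h3 h4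
      rw [h4, Pi.add_apply, h1, h2, h3]
      by_cases h5 : a ∈ s <;> by_cases h6 : a ∈ t <;> simp [h5, h6]
    rw [hM s hs, hM _ (hs.inter ht), hM _ (hs.diff ht), h1, map_add, map_add, map_add]
  have hsub : orderIntervalModuli S f ⊆
      {u : Lp ℝ 1 μ | ∀ s, MeasurableSet s → ∫ a in s, u a ∂μ ≤ M s} := by
    rintro _ ⟨g, hg, rfl⟩ s hs
    rw [hM s hs]
    refine le_trans (le_of_eq ?_) (hS.setIntegral_norm_le hR (g := g) (m := m) ?_ hs)
    · refine setIntegral_congr_ae hs ?_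
      filter_upwards [coeFn_normLp (S g)] with a ha _ using ha
    · filter_upwards [hg, hm] with b h1 h2
      rw [h2]
      exact RCLike.ofReal_le_ofReal.2 h1
  have hMuniv : M Set.univ ≤ max C 0 * ‖R‖ * ‖f‖ := by
    rw [hM _ MeasurableSet.univ]
    refine (RCLike.re_le_norm _).trans ((hC m (R (indLp 𝕜 μ MeasurableSet.univ))).trans ?_)
    have h1 := R.le_opNorm_of_le (norm_indLp_le (𝕜 := 𝕜) (μ := μ) MeasurableSet.univ)
    calc C * ‖m‖ * ‖R (indLp 𝕜 μ MeasurableSet.univ)‖ ≤ max C 0 * ‖f‖ * (‖R‖ * 1) := by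
          gcongr
          exact le_max_left _ _
      _ = max C 0 * ‖R‖ * ‖f‖ := by ring
  have hclos : supClosure (orderIntervalModuli S f) ⊆
      {u : Lp ℝ 1 μ | ∀ s, MeasurableSet s → ∫ a in s, u a ∂μ ≤ M s} :=
    supClosure_min hsub (supClosed_setIntegral_le hMadd)
  obtain ⟨w, hw, hwC⟩ := exists_isLUB_lOne (D := supClosure (orderIntervalModuli S f))
    ⟨0, subset_supClosure (zero_mem_orderIntervalModuli S f)⟩ supClosed_supClosure
    (C := max C 0 * ‖R‖ * ‖f‖) (fun u hu => by
      have h1 := hclos hu Set.univ MeasurableSet.univ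
      rw [setIntegral_univ, ← L1.integral_eq_integral, L1.integral_eq] at h1
      exact h1.trans hMuniv)
  refine ⟨w, isLUB_supClosure.1 hw, ?_⟩
  -- The family contains `0`, so `w ≥ 0` and its norm is its integral.
  rw [← integralCLM_eq_norm (hw.1 (subset_supClosure (zero_mem_orderIntervalModuli S f)))]
  exact hwC

/-- Riesz decomposition with the parts `e f / (f + g)` and `e g / (f + g)`; where `f + g = 0` also
`e = 0`, so division by zero is harmless. -/
theorem exists_add_eq_of_norm_le_add {f g e : F.carrier}
    (he : ∀ᵐ b ∂ν, ‖(e : B →ₘ[ν] 𝕜) b‖ ≤ ‖((f + g : F.carrier) : B →ₘ[ν] 𝕜) b‖) :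
    ∃ e₁ e₂ : F.carrier, e = e₁ + e₂ ∧
      (∀ᵐ b ∂ν, ‖(e₁ : B →ₘ[ν] 𝕜) b‖ ≤ ‖(f : B →ₘ[ν] 𝕜) b‖) ∧
      ∀ᵐ b ∂ν, ‖(e₂ : B →ₘ[ν] 𝕜) b‖ ≤ ‖(g : B →ₘ[ν] 𝕜) b‖ := by
  have hmeas : ∀ h : F.carrier, AEStronglyMeasurable (fun b => (e : B →ₘ[ν] 𝕜) b *
      (h : B →ₘ[ν] 𝕜) b / ((f : B →ₘ[ν] 𝕜) b + (g : B →ₘ[ν] 𝕜) b)) ν := fun h =>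
    (((AEEqFun.aestronglyMeasurable (e : B →ₘ[ν] 𝕜)).aemeasurable.mul
      (AEEqFun.aestronglyMeasurable (h : B →ₘ[ν] 𝕜)).aemeasurable).div
      ((AEEqFun.aestronglyMeasurable (f : B →ₘ[ν] 𝕜)).aemeasurable.add
      (AEEqFun.aestronglyMeasurable (g : B →ₘ[ν] 𝕜)).aemeasurable)).aestronglyMeasurable
  have he' : ∀ᵐ b ∂ν, ‖(e : B →ₘ[ν] 𝕜) b‖ ≤
      ‖(f : B →ₘ[ν] 𝕜) b + (g : B →ₘ[ν] 𝕜) b‖ := by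
    filter_upwards [he, coeFn_add f g] with b h1 h2
    rwa [h2] at h1
  have hle : ∀ h : F.carrier, ∀ᵐ b ∂ν, ‖(e : B →ₘ[ν] 𝕜) b * (h : B →ₘ[ν] 𝕜) b /
      ((f : B →ₘ[ν] 𝕜) b + (g : B →ₘ[ν] 𝕜) b)‖ ≤ ‖(h : B →ₘ[ν] 𝕜) b‖ := fun h => by
    filter_upwards [he'] with b hb
    rw [norm_div, norm_mul]
    exact div_le_of_le_mul₀ (norm_nonneg _) (norm_nonneg _)
      (by rw [mul_comm]; exact mul_le_mul_of_nonneg_left hb (norm_nonneg _))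
  obtain ⟨e₁, h1, -⟩ := F.exists_ae_eq (hmeas f) f (hle f)
  obtain ⟨e₂, h2, -⟩ := F.exists_ae_eq (hmeas g) g (hle g)
  refine ⟨e₁, e₂, ext_ae ?_, ?_, ?_⟩
  · filter_upwards [h1, h2, he', coeFn_add e₁ e₂] with b h3 h4 h5 h6
    rw [h6, h3, h4, ← add_div, ← mul_add]
    by_cases h0 : (f : B →ₘ[ν] 𝕜) b + (g : B →ₘ[ν] 𝕜) b = 0
    · rw [h0, norm_zero] at h5
      rw [norm_le_zero_iff.1 h5]
      simp
    · rw [mul_div_cancel_right₀ _ h0]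
  · filter_upwards [h1, hle f] with b h3 h4
    rwa [h3]
  · filter_upwards [h2, hle g] with b h3 h4
    rwa [h3]

/-- The supremum of the moduli over order intervals is additive on the positive cone. -/
theorem isLUB_orderIntervalModuli_add {S : F.carrier →L[𝕜] Lp 𝕜 1 μ} {f g : F.carrier}
    (hf : IsNonneg f) (hg : IsNonneg g) {u v w : Lp ℝ 1 μ} (hu : IsLUB (orderIntervalModuli S f) u)
    (hv : IsLUB (orderIntervalModuli S g) v) (hw : IsLUB (orderIntervalModuli S (f + g)) w) :
    w = u + v := by
  refine le_antisymm (hw.2 ?_) ?_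
  · rintro _ ⟨e, he, rfl⟩
    obtain ⟨e₁, e₂, rfl, h1, h2⟩ := exists_add_eq_of_norm_le_add he
    refine le_trans ?_ (add_le_add (hu.1 ⟨e₁, h1, rfl⟩) (hv.1 ⟨e₂, h2, rfl⟩))
    rw [← Lp.coeFn_le]
    filter_upwards [coeFn_normLp (S (e₁ + e₂)), coeFn_normLp (S e₁), coeFn_normLp (S e₂),
      Lp.coeFn_add (normLp (S e₁)) (normLp (S e₂)), Lp.coeFn_add (S e₁) (S e₂)]
      with a h3 h4 h5 h6 h7
    rw [h6, Pi.add_apply, h3, h4, h5, map_add, h7, Pi.add_apply]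
    exact norm_add_le _ _
  · have key : ∀ e₁ e₂ : F.carrier, (∀ᵐ b ∂ν, ‖(e₁ : B →ₘ[ν] 𝕜) b‖ ≤ ‖(f : B →ₘ[ν] 𝕜) b‖) →
        (∀ᵐ b ∂ν, ‖(e₂ : B →ₘ[ν] 𝕜) b‖ ≤ ‖(g : B →ₘ[ν] 𝕜) b‖) →
        normLp (S e₁) + normLp (S e₂) ≤ w := by
      intro e₁ e₂ h1 h2
      -- Every `e₁ + θ e₂` lies in the order interval of `f + g`; a suitable `θ` at each point turns
      -- the modulus of the sum into the sum of the moduli.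
      have h3 : ∀ θ : 𝕜, ‖θ‖ = 1 → ∀ᵐ a ∂μ, ‖S e₁ a + θ * S e₂ a‖ ≤ w a := fun θ hθ => by
        have h4 : normLp (S (e₁ + θ • e₂)) ≤ w := hw.1 ⟨_, by
          filter_upwards [h1, h2, hf, hg, coeFn_add e₁ (θ • e₂), coeFn_smul θ e₂, coeFn_add f g]
            with b h4 h5 h6 h7 h8 h9 h10
          obtain ⟨r, hr, hr'⟩ := RCLike.nonneg_iff_exists_ofReal.1 h6
          obtain ⟨t, ht, ht'⟩ := RCLike.nonneg_iff_exists_ofReal.1 h7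
          rw [h8, h9, h10, ← hr', ← ht', ← RCLike.ofReal_add, RCLike.norm_ofReal,
            abs_of_nonneg (add_nonneg hr ht)]
          rw [← hr', RCLike.norm_ofReal, abs_of_nonneg hr] at h4
          rw [← ht', RCLike.norm_ofReal, abs_of_nonneg ht] at h5
          refine (norm_add_le _ _).trans (add_le_add h4 ?_)
          rwa [norm_mul, hθ, one_mul], rfl⟩
        rw [← Lp.coeFn_le] at h4
        rw [map_add, map_smul] at h4
        filter_upwards [h4, coeFn_normLp (S e₁ + θ • S e₂), Lp.coeFn_add (S e₁) (θ • S e₂),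
          Lp.coeFn_smul θ (S e₂)] with a h5 h6 h7 h8
        rwa [h6, h7, Pi.add_apply, h8, Pi.smul_apply, smul_eq_mul] at h5
      have h4 := ae_forall_unimodular (μ := μ) (u := fun a (θ : Metric.sphere (0 : 𝕜) 1) =>
        ‖S e₁ a + (θ : 𝕜) * S e₂ a‖) (c := w) (fun a => by fun_prop) (fun θ => h3 θ (by simp))
      rw [← Lp.coeFn_le]
      filter_upwards [h4, coeFn_normLp (S e₁), coeFn_normLp (S e₂),
        Lp.coeFn_add (normLp (S e₁)) (normLp (S e₂))] with a h5 h6 h7 h8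
      rw [h8, Pi.add_apply, h6, h7]
      exact norm_add_norm_le_of_forall_unimodular fun θ hθ => h5 ⟨θ, by simpa using hθ⟩
    -- The two suprema are taken one after the other.
    refine le_sub_iff_add_le.1 (hu.2 ?_)
    rintro _ ⟨e₁, h1, rfl⟩
    refine le_sub_comm.1 (hv.2 ?_)
    rintro _ ⟨e₂, h2, rfl⟩
    exact le_sub_iff_add_le'.2 (key e₁ e₂ h1 h2)

/-- The adjoint of a dominated operator is dominated. -/
theorem IsKoetheAdjoint.isDominated {hFG : IsKoetheDualPair F G}
    {T : Lp 𝕜 ∞ μ →L[𝕜] G.carrier} {S : F.carrier →L[𝕜] Lp 𝕜 1 μ} (hS : IsKoetheAdjoint hFG T S)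
    (hT : IsDominated T) : IsDominated S := by
  obtain ⟨C, hC⟩ := hS.exists_isLUB hT
  choose p hp hpn using hC
  have hm : ∀ f, MemLp (fun a => ((p f a : ℝ) : 𝕜)) 1 μ := fun f => (Lp.memLp (p f)).ofReal
  have hm' : ∀ f, ∀ᵐ a ∂μ, (hm f).toLp _ a = ((p f a : ℝ) : 𝕜) := fun f => (hm f).coeFn_toLp
  -- The dominant is the extension of `f ↦ sup {|S g| : |g| ≤ f}` from the cone.
  obtain ⟨R, hR⟩ := exists_clm_of_nonneg (F := F) (fun f => (hm f).toLp _) (C := C)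
    (fun f g hf hg => Lp.ext (by
      filter_upwards [hm' (f + g), hm' f, hm' g, Lp.coeFn_add ((hm f).toLp _) ((hm g).toLp _),
        Lp.coeFn_add (p f) (p g)] with a h1 h2 h3 h4 h5
      rw [h1, h4, Pi.add_apply, h2, h3,
        isLUB_orderIntervalModuli_add hf hg (hp f) (hp g) (hp (f + g)), h5, Pi.add_apply,
        RCLike.ofReal_add]))
    (fun f _ => le_trans (Lp.norm_le_norm_of_ae_le (by
      filter_upwards [hm' f] with a ha
      rw [ha, RCLike.norm_ofReal, Real.norm_eq_abs])) (hpn f))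
  refine ⟨R, fun e he => ?_, fun e m hem => ?_⟩
  · rw [hR e he]
    have h1 := (Lp.coeFn_nonneg (p e)).2 ((hp e).1 (zero_mem_orderIntervalModuli S e))
    filter_upwards [hm' e, h1] with a h2 h3
    rw [h2]
    exact RCLike.ofReal_nonneg.2 h3
  · have hmn : IsNonneg m := by
      filter_upwards [hem] with b hb
      rw [hb]
      exact RCLike.ofReal_nonneg.2 (norm_nonneg _)
    rw [hR m hmn]
    have h1 : normLp (S e) ≤ p m := (hp m).1 ⟨e, by
      filter_upwards [hem] with b hb
      rw [hb]
      simp, rfl⟩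
    rw [← Lp.coeFn_le] at h1
    filter_upwards [hm' m, h1, coeFn_normLp (S e)] with a h2 h3 h4
    rw [h2]
    rw [h4] at h3
    exact RCLike.ofReal_le_ofReal.2 h3

end Modulus

/-- Uniqueness of `T_Y` is among all weak-to-weak continuous linear extensions, with no boundedness
required. -/
theorem mainTheorem2 {𝕜 : Type*} [RCLike 𝕜]
    {A : Type*} [MeasurableSpace A] (μ : Measure A) (hμ : IsSemifiniteMeasure μ)
    {B : Type*} [MeasurableSpace B] (ν : Measure B)
    (F G : BanachFunctionSpace 𝕜 ν) (hFG : IsKoetheDualPair F G)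
    (T : Lp 𝕜 ∞ μ →L[𝕜] G.carrier)
    (hTw : WeakWeakContinuous (lOneLInftyPairing μ (ContinuousLinearMap.mul 𝕜 𝕜)).flip
      hFG.pairing.flip T.toLinearMap)
    (hTM : IsDominated T) :
    -- the adjoint `S` of `T` exists
    (∃! S : F.carrier →L[𝕜] Lp 𝕜 1 μ, ∀ (f : F.carrier) (h : Lp 𝕜 ∞ μ),
      lOneLInftyPairing μ (ContinuousLinearMap.mul 𝕜 𝕜) (S f) h = hFG.pairing f (T h)) ∧
    -- `M(F, L¹(A)) = L_r(F, L¹(A))`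
    (∀ U : F.carrier →L[𝕜] Lp 𝕜 1 μ, IsDominated U ↔ IsRegularOp U) ∧
    ∀ S : F.carrier →L[𝕜] Lp 𝕜 1 μ,
      (∀ (f : F.carrier) (h : Lp 𝕜 ∞ μ),
        lOneLInftyPairing μ (ContinuousLinearMap.mul 𝕜 𝕜) (S f) h = hFG.pairing f (T h)) →
      IsRegularOp S ∧
      ∀ {X Y : Type*} [NormedAddCommGroup X] [NormedSpace 𝕜 X] [CompleteSpace X]
        [NormedAddCommGroup Y] [NormedSpace 𝕜 Y] [CompleteSpace Y]
        (β : X →L[𝕜] Y →L[𝕜] 𝕜), IsBanachDualPair β →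
        ∃ TY : Lp Y ∞ μ →L[𝕜] G.Bochner Y,
          -- `TY` is a weak-to-weak continuous extension of `T ⊗ I_Y`, and the only one
          (∀ (h : Lp 𝕜 ∞ μ) (y : Y),
            TY ((ContinuousLinearMap.toSpanSingleton 𝕜 y).compLp h) =
              BanachFunctionSpace.Bochner.tensor (T h) y) ∧
          WeakWeakContinuous (lOneLInftyPairing μ β).flip (hFG.tensorPairing β).flip
            TY.toLinearMap ∧
          (∀ U : Lp Y ∞ μ →ₗ[𝕜] G.Bochner Y,
            (∀ (h : Lp 𝕜 ∞ μ) (y : Y),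
              U ((ContinuousLinearMap.toSpanSingleton 𝕜 y).compLp h) =
                BanachFunctionSpace.Bochner.tensor (T h) y) →
            WeakWeakContinuous (lOneLInftyPairing μ β).flip (hFG.tensorPairing β).flip U →
            U = TY.toLinearMap) ∧
          -- `TY` is the `Y`-valued extension of `T` with respect to `⟨X, Y⟩`
          (∀ (h : Lp Y ∞ μ) (x : X),
            ∀ᵐ b ∂ν, β x ((TY h : B →ₘ[ν] Y) b) = (T ((β x).compLp h) : B →ₘ[ν] 𝕜) b) ∧
          ‖TY‖ ≤ dominatedNorm T ∧
          -- the adjoint `SX` of `TY` is the unique bounded extension of `S ⊗ I_X`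
          ∃ SX : F.tensorClosure X →L[𝕜] Lp X 1 μ,
            (∀ (φ : F.tensorClosure X) (h : Lp Y ∞ μ),
              lOneLInftyPairing μ β (SX φ) h = hFG.tensorPairing β φ (TY h)) ∧
            (∀ (f : F.carrier) (x : X),
              SX (BanachFunctionSpace.tensorMk f x) =
                (ContinuousLinearMap.toSpanSingleton 𝕜 x).compLp (S f)) ∧
            (∀ U : F.tensorClosure X →L[𝕜] Lp X 1 μ,
              (∀ (f : F.carrier) (x : X),
                U (BanachFunctionSpace.tensorMk f x) =
                  (ContinuousLinearMap.toSpanSingleton 𝕜 x).compLp (S f)) → U = SX) ∧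
            ‖SX‖ ≤ dominatedNorm S := by
  obtain ⟨S₀, hS₀⟩ := exists_isKoetheAdjoint hFG T hTw
  refine ⟨⟨S₀, hS₀, fun S hS => IsKoetheAdjoint.unique hS hS₀⟩,
    fun U => ⟨IsDominated.isRegularOp, IsRegularOp.isDominated⟩, fun S hS => ?_⟩
  have hSa : IsKoetheAdjoint hFG T S := hS
  have hSd : IsDominated S := hSa.isDominated hTM
  refine ⟨hSd.isRegularOp, fun {X Y} _ _ _ _ _ _ β hβ => ?_⟩
  obtain ⟨TY, hTY, hTYn⟩ := hSa.exists_valuedExtension hTM hβ.injective_right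
  obtain ⟨SX, hSX, hSXn⟩ := exists_tensorExtension (X := X) hSd
  have hadj : ∀ (φ : F.tensorClosure X) (h : Lp Y ∞ μ),
      lOneLInftyPairing μ β (SX φ) h = hFG.tensorPairing β φ (TY h) :=
    fun φ h => hSa.tensorPairing_eq hSX (hTY h) φ
  refine ⟨TY, fun h y => (hTY _).unique hβ.injective_right (isValuedImage_tensor β T h y),
    weakWeakContinuous_of_adjoint fun φ => ⟨SX φ, fun h => (hadj φ h).symm⟩,
    fun U hU hUw => ?_, hTY, hTYn, SX, hadj, hSX, fun U hU => ?_, hSXn⟩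
  -- A competing extension satisfies the same scalar identities as `TY`, and these determine the
  -- values.
  · exact LinearMap.ext fun h =>
      (hSa.isValuedImage_of_weakWeakContinuous hβ.injective_left hU hUw h).unique
        hβ.injective_right (hTY h)
  · exact tensorClosure_ext fun f x => by rw [hU, hSX]
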